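/- **Setting.** Let $T>0$, $0<H\le \tfrac12$, $I=[0,T]$, $O=(0,1)$, let $b:\mathbb R\to\mathbb R$ be Lipschitz continuous, and let $(\Omega,\mathcal F,\mathbb P)$ be a probability space. Let $\lambda_\alpha=(\alpha\pi)^2$ and $\varphi_\alpha(x)=\sqrt2\sin(\alpha\pi x)$, $\alpha\ge 1$, be the Dirichlet eigensystem of $-\Delta$ on $O$, and let $(\cdot,\cdot)$ be the inner product of $L^2=L^2(O)$. Let $\dot H^1$ be the space of all $f\in L^2$ with $\|f\|_1:=\big(\sum_\alpha\lambda_\alpha(\varphi_\alpha,f)^2\big)^{1/2}<\infty$. Let $$G_t(x,y)=\sum_{\alpha\ge1}\frac{\sin(\sqrt{\lambda_\alpha}\,t)}{\sqrt{\lambda_\alpha}}\varphi_\alpha(x)\varphi_\alpha(y)$$ be the Green's function of $\partial_{tt}-\partial_{xx}$. The integral operators on $L^2$ with kernels $G_t$ and $\partial_tG_t=\sum_\alpha\cos(\sqrt{\lambda_\alpha}\,t)\varphi_\alpha(x)\varphi_\alpha(y)$ are understood as the $L^2$-convergent series $f\mapsto\sum_\alpha\frac{\sin(\sqrt{\lambda_\alpha}t)}{\sqrt{\lambda_\alpha}}(\varphi_\alpha,f)\varphi_\alpha$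 and $f\mapsto\sum_\alpha\cos(\sqrt{\lambda_\alpha}t)(\varphi_\alpha,f)\varphi_\alpha$. Let $W=\{W(t,x)\}$ be a centred Gaussian field on $[0,T]\times[0,1]$ with $$\mathbb E[W(s,x)W(t,y)]=(s\wedge t)\,\frac{x^{2H}+y^{2H}-|x-y|^{2H}}2 .$$ For integers $m,n\ge1$ put $k=T/m$, $h=1/n$, $t_i=ik$, $x_j=jh$, and let $$\tilde\xi(t,x)=\sum_{i=0}^{m-1}\sum_{j=0}^{n-1}\frac{W(t_{i+1},x_{j+1})-W(t_i,x_{j+1})-W(t_{i+1},x_j)+W(t_i,x_j)}{kh}\,\chi_{(t_i,t_{i+1}]\times(x_j,x_{j+1}]}(t,x)$$ be the Wong–Zakai regularization of the noise $\xi=\partial_t\partial_xW$. Let $u_0,v_0$ be $L^2$-valued random variables. A *mild solution* $\tilde u$ of the regularized stochastic wave equation $\partial_{tt}\tilde u-\partial_{xx}\tilde u=b(\tilde u)+\tilde\xi$ with homogeneous Dirichlet boundary condition and initial data $\tilde u(0)=u_0$, $\partial_t\tilde u(0)=v_0$ is an $L^2$-valued process which almost surely has a Bochner integrable path on $[0,T]$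 and satisfies, for all $t\in[0,T]$, in $L^2$, $$\tilde u(t)=\int_OG_t(\cdot,y)v_0(y)\,dy+\int_O\partial_tG_t(\cdot,y)u_0(y)\,dy+\int_0^t\!\!\int_OG_{t-s}(\cdot,y)\,b(\tilde u(s,y))\,dy\,ds+\int_0^t\!\!\int_OG_{t-s}(\cdot,y)\,\tilde\xi(s,y)\,dy\,ds .$$ For $N\ge1$ let $V_N=\mathrm{span}\{\varphi_1,\dots,\varphi_N\}$ and let $P_N$ be the orthogonal projection of $L^2$ onto $V_N$. The *spectral Galerkin approximation* $\tilde u_N$ is a $V_N$-valued process which almost surely is continuous on $[0,T]$, differentiable on $(0,T]$ (one-sidedly at $T$), has $\tilde u_N(0)=P_Nu_0$ and satisfies, for all $t\in(0,T]$ and $v\in V_N$, $$(\partial_t\tilde u_N(t),v)=(P_Nv_0,v)+\int_0^t(\tilde u_N(s),\Delta v)\,ds+\int_0^t\big(b(\tilde u_N(s))+\tilde\xi(s),v\big)\,ds .$$ **Theorem.** Let $p\ge2$, $u_0\in L^p(\Omega;\dot H^1)$ and $v_0\in L^p(\Omega;L^2)$. Then there is a constant $C$, depending only on $p,T,H,u_0,v_0$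 and $b$ (in particular not on $m,n,N$), such that for all integers $m,n,N\ge1$, with $h=1/n$, $$\sup_{t\in[0,T]}\Big(\mathbb E\big[\|\tilde u(t)-\tilde u_N(t)\|_{L^2}^p\big]\Big)^{1/p}\le C\,N^{-1}h^{H-1}.$$ -/

import Mathlib

open MeasureTheory ProbabilityTheory
open scoped NNReal ENNReal

noncomputable section

namespace SWE

/-- The Hilbert space `L²(O)` on the interval `O = (0,1)`. -/
abbrev L2O : Type := Lp ℝ 2 (volume.restrict (Set.Ioo (0 : ℝ) 1))

/-! ### The Dirichlet eigensystem of `-Δ` on `(0,1)`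

The index `a : ℕ` stands for the positive integer `α = a + 1`. -/

/-- The eigenvalue `λ_α = (α π)²`, with `α = a + 1`. -/
def eigval (a : ℕ) : ℝ := (((a : ℝ) + 1) * Real.pi) ^ 2

/-- The eigenfunction `φ_α(x) = √2 sin(√λ_α x)`, with `α = a + 1`. -/
def eigfun (a : ℕ) (x : ℝ) : ℝ := Real.sqrt 2 * Real.sin (Real.sqrt (eigval a) * x)

theorem memLp_eigfun (a : ℕ) :
    MemLp (eigfun a) 2 (volume.restrict (Set.Ioo (0 : ℝ) 1)) := by
  refine MemLp.of_bound (C := Real.sqrt 2) ?_ ?_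
  · exact (by unfold eigfun; fun_prop : Continuous (eigfun a)).aestronglyMeasurable
  · refine Filter.Eventually.of_forall fun x => ?_
    rw [eigfun, norm_mul, Real.norm_eq_abs, Real.norm_eq_abs, abs_of_nonneg (Real.sqrt_nonneg 2)]
    exact mul_le_of_le_one_right (Real.sqrt_nonneg 2) (Real.abs_sin_le_one _)

/-- The eigenfunction `φ_α` as an element of `L²(O)`. -/
def eigvec (a : ℕ) : L2O := (memLp_eigfun a).toLp (eigfun a)

/-- The operator `f ↦ ∑_α c_α (φ_α, f) φ_α` (series in `L²(O)`), that is, the integral operator on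
`L²(O)` whose kernel is the series `∑_α c_α φ_α(x) φ_α(y)`. -/
def spectralOp (c : ℕ → ℝ) (f : L2O) : L2O := ∑' a, (c a * inner ℝ (eigvec a) f) • eigvec a

/-- The Dirichlet Laplacian `Δ`, with `Δ φ_α = -λ_α φ_α`. -/
def laplacian (f : L2O) : L2O := spectralOp (fun a => -eigval a) f

/-- `f ↦ ∫_O G_t(·,y) f(y) dy` for the Green's function of the wave operator `∂_tt - ∂_xx`,
`G_t(x,y) = ∑_α sin(√λ_α t) / √λ_α · φ_α(x) φ_α(y)`. -/
def greenOp (t : ℝ) (f : L2O) : L2O :=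
  spectralOp (fun a => Real.sin (Real.sqrt (eigval a) * t) / Real.sqrt (eigval a)) f

/-- `f ↦ ∫_O ∂_t G_t(·,y) f(y) dy`, where
`∂_t G_t(x,y) = ∑_α cos(√λ_α t) · φ_α(x) φ_α(y)`. -/
def greenDerivOp (t : ℝ) (f : L2O) : L2O :=
  spectralOp (fun a => Real.cos (Real.sqrt (eigval a) * t)) f

/-- The norm `‖f‖_β = ‖(-Δ)^{β/2} f‖_{L²} = (∑_α λ_α^β (φ_α, f)²)^{1/2}` of `Ḣ^β`, for `f` in
`L²(O)` (so `β ≥ 0`); it is `∞` exactly when `f` is not in `Ḣ^β`. -/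
def hdotNorm (β : ℝ) (f : L2O) : ℝ≥0∞ :=
  (∑' a, ENNReal.ofReal (eigval a ^ β * inner ℝ (eigvec a) f ^ 2)) ^ (1 / 2 : ℝ)

/-- `f ∈ L^p(Ω; Ḣ^β)`, for `β ≥ 0`. -/
def MemLpHdot {Ω : Type*} [MeasurableSpace Ω] (β p : ℝ) (f : Ω → L2O) (P : Measure Ω) : Prop :=
  AEStronglyMeasurable f P ∧ ∫⁻ ω, hdotNorm β (f ω) ^ p ∂P < ∞

/-! ### The drift -/

theorem memLp_comp_lipschitz {b : ℝ → ℝ} {K : ℝ≥0} (hb : LipschitzWith K b) (f : L2O) :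
    MemLp (fun x => b (f x)) 2 (volume.restrict (Set.Ioo (0 : ℝ) 1)) := by
  have h1 : LipschitzWith K (fun y => b y - b 0) := by
    intro x y
    simpa [edist_sub_right] using hb x y
  have h2 := (h1.comp_memLp (by simp) (Lp.memLp f)).add
    (memLp_const (μ := volume.restrict (Set.Ioo (0 : ℝ) 1)) (p := 2) (b 0))
  refine h2.ae_eq (Filter.Eventually.of_forall fun x => ?_)
  simp

/-- The superposition operator `f ↦ b(f(·))` on `L²(O)` of a Lipschitz function `b`. -/
def drift {b : ℝ → ℝ} {K : ℝ≥0} (hb : LipschitzWith K b) (f : L2O) : L2O :=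
  (memLp_comp_lipschitz hb f).toLp (fun x => b (f x))

/-! ### The noise and its Wong-Zakai regularization -/

/-- `W` is (on `[0,T] × [0,1]`) a fractional Gaussian sheet: a centred Gaussian field with
covariance `E[W(s,x) W(t,y)] = (s ∧ t) (x^{2H} + y^{2H} - |x-y|^{2H}) / 2`. -/
structure IsFractionalSheet {Ω : Type*} [MeasurableSpace Ω] (P : Measure Ω) (T H : ℝ)
    (W : ℝ → ℝ → Ω → ℝ) : Prop where
  gaussian : IsGaussianProcess
    (fun (q : (Set.Icc 0 T ×ˢ Set.Icc 0 1 : Set (ℝ × ℝ))) => W q.1.1 q.1.2) P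
  centered : ∀ t ∈ Set.Icc 0 T, ∀ x ∈ Set.Icc (0 : ℝ) 1, ∫ ω, W t x ω ∂P = 0
  covariance : ∀ s ∈ Set.Icc 0 T, ∀ x ∈ Set.Icc (0 : ℝ) 1,
    ∀ t ∈ Set.Icc 0 T, ∀ y ∈ Set.Icc (0 : ℝ) 1,
      ∫ ω, W s x ω * W t y ω ∂P =
        min s t * ((x ^ (2 * H) + y ^ (2 * H) - |x - y| ^ (2 * H)) / 2)

/-- The stochastic integral `∫_{(s,t]} ∫_{(x,y]} ξ(dr,dz)` of the indicator of a rectangle, that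
is, the rectangular increment of the sheet `W`. -/
def sheetIncrement {Ω : Type*} (W : ℝ → ℝ → Ω → ℝ) (s t x y : ℝ) (ω : Ω) : ℝ :=
  W t y ω - W s y ω - W t x ω + W s x ω

/-- The indicator of `(x,y] ∩ O` as an element of `L²(O)`. -/
def cellIndicator (x y : ℝ) : L2O :=
  indicatorConstLp 2 (measurableSet_Ioc (a := x) (b := y)) (measure_ne_top _ _) (1 : ℝ)

/-- The regularized noise, as an `L²(O)`-valued process:
`ξ̃(t,·) = ∑_{i<m} ∑_{j<n} (1/(kh)) (∫_{I_i} ∫_{O_j} ξ(ds,dy)) χ_{I_i × O_j}(t,·)`, with `k = T/m`,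
`h = 1/n`, `I_i = (ik,(i+1)k]` and `O_j = (jh,(j+1)h]`. -/
def regNoise {Ω : Type*} (T : ℝ) (m n : ℕ) (W : ℝ → ℝ → Ω → ℝ) (t : ℝ) (ω : Ω) : L2O :=
  let k : ℝ := T / m
  let h : ℝ := 1 / n
  ∑ i ∈ Finset.range m, ∑ j ∈ Finset.range n,
    (1 / (k * h) * sheetIncrement W (i * k) ((i + 1) * k) (j * h) ((j + 1) * h) ω
      * (Set.Ioc (i * k) ((i + 1) * k)).indicator (fun _ => (1 : ℝ)) t)
      • cellIndicator (j * h) ((j + 1) * h)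

/-! ### Mild solution and spectral Galerkin approximation -/

/-- `u` is a mild solution on `[0,T]` of `∂_tt u - ∂_xx u = b(u) + η` with the homogeneous
Dirichlet boundary condition, `u(0) = u₀` and `∂_t u(0) = v₀`: almost surely the path of `u` is
(Bochner) integrable in `L²(O)` and, for all `t ∈ [0,T]`,
`u(t) = ∫ G_t v₀ + ∫ ∂_t G_t u₀ + ∫_0^t ∫ G_{t-s} b(u(s)) ds + ∫_0^t ∫ G_{t-s} η(s) ds`. -/
def IsMildSolution {Ω : Type*} [MeasurableSpace Ω] (P : Measure Ω) (T : ℝ)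
    {b : ℝ → ℝ} {K : ℝ≥0} (hb : LipschitzWith K b) (u₀ v₀ : Ω → L2O) (η : ℝ → Ω → L2O)
    (u : ℝ → Ω → L2O) : Prop :=
  ∀ᵐ ω ∂P, IntegrableOn (fun s => u s ω) (Set.Icc 0 T) ∧
    ∀ t ∈ Set.Icc 0 T,
      u t ω = greenOp t (v₀ ω) + greenDerivOp t (u₀ ω)
        + (∫ s in (0 : ℝ)..t, greenOp (t - s) (drift hb (u s ω)))
        + ∫ s in (0 : ℝ)..t, greenOp (t - s) (η s ω)

/-- `V_N = span {φ_1, …, φ_N}`. -/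
def galerkinSpace (N : ℕ) : Submodule ℝ L2O :=
  Submodule.span ℝ (Set.range fun a : Fin N => eigvec a)

instance (N : ℕ) : FiniteDimensional ℝ (galerkinSpace N) :=
  FiniteDimensional.span_of_finite ℝ (Set.finite_range _)

/-- The orthogonal projection `P_N` of `L²(O)` onto `V_N`. -/
def galerkinProj (N : ℕ) (f : L2O) : L2O := (galerkinSpace N).starProjection f

/-- `uN` is a spectral Galerkin approximation, with `N` modes, of the wave equation with forcing
`η`: almost surely, `uN` has a continuous path in `V_N` with `uN(0) = P_N u₀`, and for all
`t ∈ (0,T]` the time derivative exists and satisfies, for all `v ∈ V_N`,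
`(∂_t uN(t), v) = (P_N v₀, v) + ∫_0^t (uN(s), Δv) ds + ∫_0^t (b(uN(s)) + η(s), v) ds`.
The derivative at `t = T` is one-sided. -/
def IsSpectralGalerkin {Ω : Type*} [MeasurableSpace Ω] (P : Measure Ω) (T : ℝ) (N : ℕ)
    {b : ℝ → ℝ} {K : ℝ≥0} (hb : LipschitzWith K b) (u₀ v₀ : Ω → L2O) (η : ℝ → Ω → L2O)
    (uN : ℝ → Ω → L2O) : Prop :=
  ∀ᵐ ω ∂P, (∀ t ∈ Set.Icc 0 T, uN t ω ∈ galerkinSpace N) ∧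
    ContinuousOn (fun t => uN t ω) (Set.Icc 0 T) ∧
    uN 0 ω = galerkinProj N (u₀ ω) ∧
    ∀ t ∈ Set.Ioc 0 T, ∃ w : L2O,
      HasDerivWithinAt (fun s => uN s ω) w (Set.Icc 0 T) t ∧
      ∀ v ∈ galerkinSpace N,
        inner ℝ w v = inner ℝ (galerkinProj N (v₀ ω)) v
          + (∫ s in (0 : ℝ)..t, inner ℝ (uN s ω) (laplacian v))
          + ∫ s in (0 : ℝ)..t, inner ℝ (drift hb (uN s ω) + η s ω) v

end SWE

end

/-! Expand in the eigenfunctions. The mode index starts at 0, so the modes outside `V_N` are those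
with `a ≥ N`, and their frequencies are at least `N + 1`. On the modes below `N` both solutions obey
the same variation of constants formula (`inner_galerkin_eq`). There the initial data and the noise
cancel, and only the difference of the drifts remains. Hence the error is at most the tail of the
mild solution plus `K` times the time integral of the error (`enorm_sub_galerkin_le`), and the
integrated Gronwall inequality `lintegral_le_of_le_add_lintegral` closes the estimate.

The tail gains a factor `1 / (N + 1)` from the denominator of the Green's function, or from the `Ḣ¹`
norm of `u₀` for the cosine term. The drift part of the tail needs a bound on the time integral of
`‖u‖`, which comes from the same Gronwall inequality.

The stochastic convolution is treated in probability. Each of its modes is a finite linear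
combination of rectangular increments of `W`, hence a centred Gaussian variable. Increments over
different time slabs are uncorrelated. Within a slab, `2H ≤ 1` makes distinct increments
nonpositively correlated, with absolute row sums of the correlation matrix at most 2, so the
covariance form is at most `2 k h^(2H)` times the identity (`integral_sq_sum_gridIncrement_le`).
Bessel's inequality on the cell indicators sums the modes and yields the second moment bound `2 T
h^(2H-2) / (N + 1)²` (`tsum_noise_variance_le`). Gaussian scaling and Minkowski's inequality in
`L^(p/2)` give the `p`-th moments.

All pathwise bounds are in `[0,∞]`, with explicit measurable right-hand sides, so no measurability
in `ω` of the solutions is needed. -/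

noncomputable section

namespace SWE

/-! ### Diagonal operators with respect to an orthonormal sequence -/

section Diagonal

variable {E : Type*} [NormedAddCommGroup E] [InnerProductSpace ℝ E]

/-- The operator `f ↦ ∑_a c_a (e_a, f) e_a`. -/
def diagOp (e : ℕ → E) (c : ℕ → ℝ) (f : E) : E := ∑' a, (c a * inner ℝ (e a) f) • e a

theorem diagOp_diagOp_of_inner {e : ℕ → E} {c d : ℕ → ℝ} {f g : E}
    (h : ∀ a, inner ℝ (e a) g = d a * inner ℝ (e a) f) :
    diagOp e c g = diagOp e (fun a => c a * d a) f := by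
  simp only [diagOp, h, mul_assoc]

theorem diagOp_congr {e : ℕ → E} {c : ℕ → ℝ} {f g : E}
    (h : ∀ a, c a * inner ℝ (e a) f = c a * inner ℝ (e a) g) :
    diagOp e c f = diagOp e c g := by
  simp only [diagOp, h]

theorem diagOp_single {e : ℕ → E} (he : Orthonormal ℝ e) (c : ℕ → ℝ) (b : ℕ) :
    diagOp e c (e b) = c b • e b := by
  rw [diagOp, tsum_eq_single b]
  · rw [real_inner_self_eq_norm_sq, he.1 b]; simp
  · intro a hab
    rw [he.2 hab]; simp

variable {e : ℕ → E} {c d : ℕ → ℝ} {M : ℝ}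

theorem summable_sq_coeff (he : Orthonormal ℝ e) (hc : ∀ a, |c a| ≤ M) (f : E) :
    Summable (fun a => (c a * inner ℝ (e a) f) ^ 2) := by
  refine Summable.of_nonneg_of_le (fun a => sq_nonneg _) (fun a => ?_)
    ((he.inner_products_summable (x := f)).mul_left (M ^ 2))
  rw [mul_pow, Real.norm_eq_abs, sq_abs]
  exact mul_le_mul_of_nonneg_right (sq_le_sq' (abs_le.1 (hc a)).1 (abs_le.1 (hc a)).2) (sq_nonneg _)

variable [CompleteSpace E]

theorem hasSum_diagOp (he : Orthonormal ℝ e) (hc : ∀ a, |c a| ≤ M) (f : E) :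
    HasSum (fun a => (c a * inner ℝ (e a) f) • e a) (diagOp e c f) := by
  refine Summable.hasSum ?_
  have := (he.orthogonalFamily.summable_iff_norm_sq_summable
    (fun a => c a * inner ℝ (e a) f)).2 ?_
  · simpa using this
  · simpa only [Real.norm_eq_abs, sq_abs] using summable_sq_coeff he hc f

theorem inner_diagOp (he : Orthonormal ℝ e) (hc : ∀ a, |c a| ≤ M) (f : E) (b : ℕ) :
    inner ℝ (e b) (diagOp e c f) = c b * inner ℝ (e b) f := by
  have h := (hasSum_diagOp he hc f).mapL (innerSL ℝ (e b))
  have h' : HasSum (fun a => innerSL ℝ (e b) ((c a * inner ℝ (e a) f) • e a))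
      (innerSL ℝ (e b) ((c b * inner ℝ (e b) f) • e b)) :=
    hasSum_single b fun a hab => by simp [he.2 hab.symm]
  rw [← innerSL_apply_apply ℝ, h.unique h', innerSL_apply_apply, inner_smul_right,
    real_inner_self_eq_norm_sq, he.1 b]
  simp

/-- Pairing the convergent series with its own sum gives Parseval's identity for the image;
completeness of the system `e` is not needed. -/
theorem hasSum_sq_diagOp (he : Orthonormal ℝ e) (hc : ∀ a, |c a| ≤ M) (f : E) :
    HasSum (fun a => (c a * inner ℝ (e a) f) ^ 2) (‖diagOp e c f‖ ^ 2) := by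
  have h := (hasSum_diagOp he hc f).mapL (innerSL ℝ (diagOp e c f))
  rw [innerSL_apply_apply, real_inner_self_eq_norm_sq] at h
  convert! h using 2 with a
  rw [innerSL_apply_apply, inner_smul_right, real_inner_comm (e a) (diagOp e c f),
    inner_diagOp he hc, sq]

theorem norm_diagOp_le (he : Orthonormal ℝ e) (hM : 0 ≤ M) (hc : ∀ a, |c a| ≤ M) (f : E) :
    ‖diagOp e c f‖ ≤ M * ‖f‖ := by
  refine (sq_le_sq₀ (norm_nonneg _) (by positivity)).1 ?_
  rw [← (hasSum_sq_diagOp he hc f).tsum_eq, mul_pow]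
  calc ∑' a, (c a * inner ℝ (e a) f) ^ 2
      ≤ ∑' a, M ^ 2 * ‖inner ℝ (e a) f‖ ^ 2 := by
        refine (summable_sq_coeff he hc f).tsum_le_tsum (fun a => ?_)
          ((he.inner_products_summable (x := f)).mul_left (M ^ 2))
        rw [mul_pow, Real.norm_eq_abs, sq_abs]
        exact mul_le_mul_of_nonneg_right (sq_le_sq' (abs_le.1 (hc a)).1 (abs_le.1 (hc a)).2)
          (sq_nonneg _)
    _ ≤ M ^ 2 * ‖f‖ ^ 2 := by
        rw [tsum_mul_left]
        gcongr
        exact he.tsum_inner_products_le f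

/-- A diagonal operator with bounded coefficients, as a continuous linear map. -/
def diagCLM (he : Orthonormal ℝ e) (hM : 0 ≤ M) (hc : ∀ a, |c a| ≤ M) : E →L[ℝ] E :=
  LinearMap.mkContinuous
    { toFun := diagOp e c
      map_add' := fun f g => by
        refine (hasSum_diagOp he hc (f + g)).unique ?_
        convert! (hasSum_diagOp he hc f).add (hasSum_diagOp he hc g) using 2 with a
        rw [inner_add_right, mul_add, add_smul]
      map_smul' := fun r f => by
        refine (hasSum_diagOp he hc (r • f)).unique ?_
        convert! (hasSum_diagOp he hc f).const_smul r using 2 with a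
        rw [inner_smul_right, smul_smul]
        exact congrArg (· • e a) (by ring) } M (norm_diagOp_le he hM hc)

theorem diagCLM_apply (he : Orthonormal ℝ e) (hM : 0 ≤ M) (hc : ∀ a, |c a| ≤ M) (f : E) :
    diagCLM he hM hc f = diagOp e c f := rfl

theorem diagOp_sub_coeff (he : Orthonormal ℝ e) {M' : ℝ} (hc : ∀ a, |c a| ≤ M)
    (hd : ∀ a, |d a| ≤ M') (f : E) :
    diagOp e c f - diagOp e d f = diagOp e (fun a => c a - d a) f := by
  refine ((hasSum_diagOp he hc f).sub (hasSum_diagOp he hd f)).unique ?_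
  convert! hasSum_diagOp he (c := fun a => c a - d a) (M := M + M') (fun a => ?_) f using 2 with a
  · rw [← sub_smul, sub_mul]
  · exact (abs_sub _ _).trans (add_le_add (hc a) (hd a))

theorem enorm_diagOp (he : Orthonormal ℝ e) (hc : ∀ a, |c a| ≤ M) (f : E) :
    ‖diagOp e c f‖ₑ = (∑' a, ENNReal.ofReal ((c a * inner ℝ (e a) f) ^ 2)) ^ (1 / 2 : ℝ) := by
  rw [← ENNReal.ofReal_tsum_of_nonneg (fun a => sq_nonneg _) (summable_sq_coeff he hc f),
    (hasSum_sq_diagOp he hc f).tsum_eq, ENNReal.ofReal_rpow_of_nonneg (by positivity) (by norm_num),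
    ← Real.sqrt_eq_rpow, Real.sqrt_sq (norm_nonneg _), ofReal_norm]

/-- The indicator of the modes `a ≥ N`. -/
def tailCoeff (N a : ℕ) : ℝ := if N ≤ a then 1 else 0

/-- The indicator of the modes `a < N`. -/
def headCoeff (N a : ℕ) : ℝ := if a < N then 1 else 0

theorem abs_tailCoeff_le (N a : ℕ) : |tailCoeff N a| ≤ 1 := by
  unfold tailCoeff; split_ifs <;> simp

theorem abs_headCoeff_le (N a : ℕ) : |headCoeff N a| ≤ 1 := by
  unfold headCoeff; split_ifs <;> simp

theorem tailCoeff_zero (a : ℕ) : tailCoeff 0 a = 1 := by simp [tailCoeff]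

theorem headCoeff_add_tailCoeff (N a : ℕ) : headCoeff N a + tailCoeff N a = 1 := by
  unfold headCoeff tailCoeff
  split_ifs <;> first | omega | simp

end Diagonal

/-! ### The Dirichlet eigensystem -/

theorem sqrt_eigval (a : ℕ) : Real.sqrt (eigval a) = ((a : ℝ) + 1) * Real.pi :=
  Real.sqrt_sq (by positivity)

theorem sqrt_eigval_pos (a : ℕ) : 0 < Real.sqrt (eigval a) := by
  rw [sqrt_eigval]; positivity

/-- This is the source of the rate in `N`. The factor `π` is simply dropped. -/
theorem add_one_le_sqrt_eigval {N a : ℕ} (h : N ≤ a) : (N : ℝ) + 1 ≤ Real.sqrt (eigval a) := by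
  rw [sqrt_eigval]
  have h1 : (N : ℝ) ≤ a := by exact_mod_cast h
  have h2 : (1 : ℝ) ≤ Real.pi := by linarith [Real.pi_gt_three]
  nlinarith

theorem integral_cos_int_mul_pi (k : ℤ) (hk : k ≠ 0) :
    ∫ x in (0 : ℝ)..1, Real.cos (k * Real.pi * x) = 0 := by
  have hc : (k : ℝ) * Real.pi ≠ 0 := mul_ne_zero (by exact_mod_cast hk) Real.pi_ne_zero
  rw [intervalIntegral.integral_comp_mul_left (fun x => Real.cos x) hc]
  simp [Real.sin_int_mul_pi]

/-- Product-to-sum: the frequencies `(a - b)π` and `(a + b + 2)π` are integer multiples of `π`, and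
their cosines integrate to zero unless the frequency vanishes. -/
theorem integral_eigfun_mul (a b : ℕ) :
    ∫ x in (0 : ℝ)..1, eigfun a x * eigfun b x = if a = b then 1 else 0 := by
  have h : ∀ x : ℝ, eigfun a x * eigfun b x
      = Real.cos (((a : ℤ) - b : ℤ) * Real.pi * x)
        - Real.cos (((a : ℤ) + b + 2 : ℤ) * Real.pi * x) := by
    intro x
    have h2 : Real.sqrt 2 * Real.sqrt 2 = 2 := Real.mul_self_sqrt (by norm_num)
    have e1 : ((((a : ℤ) - b : ℤ) : ℝ) * Real.pi * x)
        = ((a : ℝ) + 1) * Real.pi * x - ((b : ℝ) + 1) * Real.pi * x := by push_cast; ring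
    have e2 : ((((a : ℤ) + b + 2 : ℤ) : ℝ) * Real.pi * x)
        = ((a : ℝ) + 1) * Real.pi * x + ((b : ℝ) + 1) * Real.pi * x := by push_cast; ring
    rw [e1, e2, Real.cos_sub, Real.cos_add, eigfun, eigfun, sqrt_eigval, sqrt_eigval]
    linear_combination (Real.sin (((a : ℝ) + 1) * Real.pi * x) *
      Real.sin (((b : ℝ) + 1) * Real.pi * x)) * h2
  simp_rw [h]
  rw [intervalIntegral.integral_sub (Continuous.intervalIntegrable (by fun_prop) _ _)
    (Continuous.intervalIntegrable (by fun_prop) _ _),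
    integral_cos_int_mul_pi ((a : ℤ) + b + 2) (by omega), sub_zero]
  split_ifs with hab
  · subst hab; simp
  · exact integral_cos_int_mul_pi _ (by omega)

theorem orthonormal_eigvec : Orthonormal ℝ eigvec := by
  rw [orthonormal_iff_ite]
  intro a b
  rw [← integral_eigfun_mul, L2.inner_def, intervalIntegral.integral_of_le zero_le_one,
    integral_Ioc_eq_integral_Ioo]
  refine integral_congr_ae ?_
  filter_upwards [(memLp_eigfun a).coeFn_toLp, (memLp_eigfun b).coeFn_toLp] with x ha hb
  rw [eigvec, eigvec, ha, hb]
  simp [mul_comm]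

/-! ### The wave propagators -/

theorem abs_green_coeff_le {N a : ℕ} (h : N ≤ a) (t : ℝ) :
    |Real.sin (Real.sqrt (eigval a) * t) / Real.sqrt (eigval a)| ≤ ((N : ℝ) + 1)⁻¹ := by
  rw [abs_div, abs_of_pos (sqrt_eigval_pos a), div_eq_mul_inv, ← one_mul ((N : ℝ) + 1)⁻¹]
  have := sqrt_eigval_pos a
  gcongr
  · exact Real.abs_sin_le_one _
  · exact add_one_le_sqrt_eigval h

theorem abs_green_coeff_le_one (t : ℝ) (a : ℕ) :
    |Real.sin (Real.sqrt (eigval a) * t) / Real.sqrt (eigval a)| ≤ 1 := by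
  simpa using abs_green_coeff_le (Nat.zero_le a) t

theorem abs_greenDeriv_coeff_le_one (t : ℝ) (a : ℕ) :
    |Real.cos (Real.sqrt (eigval a) * t)| ≤ 1 := Real.abs_cos_le_one _

theorem inner_greenOp (t : ℝ) (f : L2O) (a : ℕ) :
    inner ℝ (eigvec a) (greenOp t f)
      = Real.sin (Real.sqrt (eigval a) * t) / Real.sqrt (eigval a) * inner ℝ (eigvec a) f :=
  inner_diagOp orthonormal_eigvec (abs_green_coeff_le_one t) f a

theorem inner_greenDerivOp (t : ℝ) (f : L2O) (a : ℕ) :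
    inner ℝ (eigvec a) (greenDerivOp t f)
      = Real.cos (Real.sqrt (eigval a) * t) * inner ℝ (eigvec a) f :=
  inner_diagOp orthonormal_eigvec (abs_greenDeriv_coeff_le_one t) f a

theorem norm_greenOp_le (t : ℝ) (f : L2O) : ‖greenOp t f‖ ≤ ‖f‖ :=
  (norm_diagOp_le orthonormal_eigvec zero_le_one (abs_green_coeff_le_one t) f).trans_eq (one_mul _)

theorem greenOp_sub (t : ℝ) (f g : L2O) : greenOp t (f - g) = greenOp t f - greenOp t g :=
  map_sub (diagCLM orthonormal_eigvec zero_le_one (abs_green_coeff_le_one t)) f g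

/-- The sine is 1-Lipschitz, and the frequency this produces cancels against the denominator, so the
bound is uniform over the modes. It serves the joint continuity of the propagator, from which the
measurability of the convolution integrands follows. -/
theorem norm_greenOp_sub_le (s t : ℝ) (f : L2O) :
    ‖greenOp t f - greenOp s f‖ ≤ |t - s| * ‖f‖ := by
  have h := diagOp_sub_coeff orthonormal_eigvec (abs_green_coeff_le_one t)
    (abs_green_coeff_le_one s) f
  refine le_trans (le_of_eq (congrArg norm h))
    (norm_diagOp_le orthonormal_eigvec (abs_nonneg _) (fun a => ?_) f)
  have hp := sqrt_eigval_pos a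
  rw [← sub_div, abs_div, abs_of_pos hp, div_le_iff₀ hp]
  calc |Real.sin (Real.sqrt (eigval a) * t) - Real.sin (Real.sqrt (eigval a) * s)|
      ≤ |Real.sqrt (eigval a) * t - Real.sqrt (eigval a) * s| := by
        simpa [Real.dist_eq] using Real.lipschitzWith_sin.dist_le_mul
          (Real.sqrt (eigval a) * t) (Real.sqrt (eigval a) * s)
    _ = |t - s| * Real.sqrt (eigval a) := by
        rw [← mul_sub, abs_mul, abs_of_pos hp, mul_comm]

theorem continuous_greenOp : Continuous fun q : ℝ × L2O => greenOp q.1 q.2 := by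
  rw [continuous_iff_continuousAt]
  rintro ⟨t, f⟩
  rw [ContinuousAt, tendsto_iff_norm_sub_tendsto_zero]
  have hlim : Filter.Tendsto (fun q : ℝ × L2O => ‖q.2 - f‖ + |q.1 - t| * ‖f‖)
      (nhds (t, f)) (nhds 0) := by
    have : Continuous fun q : ℝ × L2O => ‖q.2 - f‖ + |q.1 - t| * ‖f‖ := by fun_prop
    simpa using this.tendsto (t, f)
  refine squeeze_zero (fun _ => norm_nonneg _) (fun q => ?_) hlim
  calc ‖greenOp q.1 q.2 - greenOp t f‖
      = ‖greenOp q.1 (q.2 - f) + (greenOp q.1 f - greenOp t f)‖ := by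
        rw [greenOp_sub]; congr 1; abel
    _ ≤ _ := (norm_add_le _ _).trans
        (add_le_add (norm_greenOp_le _ _) (norm_greenOp_sub_le _ _ _))

/-! ### Spectral truncation -/

/-- The continuous linear map `f ↦ ∑_{a ≥ N} (φ_a, f) φ_a`. -/
def tailProj (N : ℕ) : L2O →L[ℝ] L2O :=
  diagCLM orthonormal_eigvec zero_le_one (abs_tailCoeff_le N)

/-- The continuous linear map `f ↦ ∑_{a < N} (φ_a, f) φ_a`. -/
def headProj (N : ℕ) : L2O →L[ℝ] L2O :=
  diagCLM orthonormal_eigvec zero_le_one (abs_headCoeff_le N)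

theorem norm_headProj_le (N : ℕ) (f : L2O) : ‖headProj N f‖ ≤ ‖f‖ :=
  (norm_diagOp_le orthonormal_eigvec zero_le_one (abs_headCoeff_le N) f).trans_eq (one_mul _)

/-- The right-hand side is the projection onto the closed span of the eigenfunctions. Writing it
instead of `f` avoids the completeness of the sine system. -/
theorem headProj_add_tailProj (N : ℕ) (f : L2O) : headProj N f + tailProj N f = tailProj 0 f := by
  have h := diagOp_sub_coeff orthonormal_eigvec (abs_tailCoeff_le 0) (abs_tailCoeff_le N) f
  have h2 : (fun a => tailCoeff 0 a - tailCoeff N a) = headCoeff N := by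
    funext a; rw [tailCoeff_zero, ← headCoeff_add_tailCoeff N a]; ring
  rw [h2] at h
  exact (sub_eq_iff_eq_add.1 h).symm

theorem headProj_congr {N : ℕ} {f g : L2O}
    (h : ∀ a < N, inner ℝ (eigvec a) f = inner ℝ (eigvec a) g) : headProj N f = headProj N g := by
  refine diagOp_congr fun a => ?_
  by_cases ha : a < N
  · rw [h a ha]
  · simp [headCoeff, ha]

theorem headProj_of_mem {N : ℕ} {f : L2O} (hf : f ∈ galerkinSpace N) : headProj N f = f := by
  refine Submodule.span_induction (p := fun f _ => headProj N f = f) ?_ ?_ ?_ ?_ hf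
  · rintro _ ⟨a, rfl⟩
    have := diagOp_single orthonormal_eigvec (headCoeff N) a
    simpa [headProj, diagCLM_apply, headCoeff] using this
  · exact map_zero _
  · intro x y _ _ hx hy; rw [map_add, hx, hy]
  · intro r x _ hx; rw [map_smul, hx]

theorem eigvec_mem_galerkinSpace {N a : ℕ} (ha : a < N) : eigvec a ∈ galerkinSpace N :=
  Submodule.subset_span ⟨⟨a, ha⟩, rfl⟩

theorem inner_galerkinProj {N a : ℕ} (ha : a < N) (f : L2O) :
    inner ℝ (eigvec a) (galerkinProj N f) = inner ℝ (eigvec a) f := by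
  rw [galerkinProj, ← Submodule.inner_starProjection_left_eq_right,
    Submodule.starProjection_eq_self_iff.2 (eigvec_mem_galerkinSpace ha)]

theorem laplacian_eigvec (a : ℕ) : laplacian (eigvec a) = (-eigval a) • eigvec a :=
  diagOp_single orthonormal_eigvec _ a

theorem tailProj_zero_greenOp (t : ℝ) (f : L2O) : tailProj 0 (greenOp t f) = greenOp t f := by
  refine (diagOp_diagOp_of_inner (inner_greenOp t f)).trans ?_
  simp only [tailCoeff_zero, one_mul]; rfl

theorem tailProj_zero_greenDerivOp (t : ℝ) (f : L2O) :
    tailProj 0 (greenDerivOp t f) = greenDerivOp t f := by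
  refine (diagOp_diagOp_of_inner (inner_greenDerivOp t f)).trans ?_
  simp only [tailCoeff_zero, one_mul]; rfl

theorem norm_tailProj_greenOp_le (N : ℕ) (t : ℝ) (f : L2O) :
    ‖tailProj N (greenOp t f)‖ ≤ ((N : ℝ) + 1)⁻¹ * ‖f‖ := by
  have h : tailProj N (greenOp t f) = _ := diagOp_diagOp_of_inner (inner_greenOp t f)
  rw [h]
  refine norm_diagOp_le orthonormal_eigvec (by positivity) (fun a => ?_) f
  by_cases ha : N ≤ a
  · simpa [tailCoeff, ha] using abs_green_coeff_le ha t
  · simp only [tailCoeff, ha, if_false, zero_mul, abs_zero]; positivity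

/-- The cosine has no decay in the mode, so the gain is taken from the regularity of `f`: on the
tail, `1 ≤ (N + 1)⁻² λ_a`. -/
theorem enorm_tailProj_greenDerivOp_le (N : ℕ) (t : ℝ) (f : L2O) :
    ‖tailProj N (greenDerivOp t f)‖ₑ ≤ ENNReal.ofReal ((N : ℝ) + 1)⁻¹ * hdotNorm 1 f := by
  have h : tailProj N (greenDerivOp t f) = diagOp eigvec (tailCoeff N) (greenDerivOp t f) := rfl
  rw [h, enorm_diagOp orthonormal_eigvec (abs_tailCoeff_le N), hdotNorm]
  have h2 : ENNReal.ofReal ((N : ℝ) + 1)⁻¹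
      = (ENNReal.ofReal (((N : ℝ) + 1)⁻¹ ^ 2)) ^ (1 / 2 : ℝ) := by
    rw [ENNReal.ofReal_rpow_of_nonneg (by positivity) (by norm_num), ← Real.sqrt_eq_rpow,
      Real.sqrt_sq (by positivity)]
  rw [h2, ← ENNReal.mul_rpow_of_nonneg _ _ (by norm_num), ← ENNReal.tsum_mul_left]
  refine ENNReal.rpow_le_rpow (ENNReal.tsum_le_tsum fun a => ?_) (by norm_num)
  rw [← ENNReal.ofReal_mul (by positivity)]
  refine ENNReal.ofReal_le_ofReal ?_
  rw [inner_greenDerivOp, Real.rpow_one, ← mul_assoc, ← mul_assoc, mul_pow]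
  refine mul_le_mul_of_nonneg_right ?_ (sq_nonneg _)
  by_cases ha : N ≤ a
  · rw [tailCoeff, if_pos ha, one_mul]
    calc Real.cos (Real.sqrt (eigval a) * t) ^ 2 ≤ 1 := Real.cos_sq_le_one _
      _ = (((N : ℝ) + 1)⁻¹ * ((N : ℝ) + 1)) ^ 2 := by
        rw [inv_mul_cancel₀ (by positivity)]; norm_num
      _ ≤ ((N : ℝ) + 1)⁻¹ ^ 2 * eigval a := by
        rw [mul_pow]
        have h3 : ((N : ℝ) + 1) ^ 2 ≤ eigval a := by
          rw [← Real.sq_sqrt (show 0 ≤ eigval a by unfold eigval; positivity)]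
          have := add_one_le_sqrt_eigval ha
          gcongr
        gcongr
  · have : 0 ≤ eigval a := by unfold eigval; positivity
    simp only [tailCoeff, ha, if_false, zero_mul, ne_eq, OfNat.ofNat_ne_zero, not_false_eq_true,
      zero_pow]
    positivity

/-! ### The superposition operator -/

theorem norm_drift_sub_le {b : ℝ → ℝ} {K : ℝ≥0} (hb : LipschitzWith K b) (f g : L2O) :
    ‖drift hb f - drift hb g‖ ≤ K * ‖f - g‖ := by
  refine Lp.norm_le_mul_norm_of_ae_le_mul ?_
  filter_upwards [Lp.coeFn_sub (drift hb f) (drift hb g), Lp.coeFn_sub f g,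
    (memLp_comp_lipschitz hb f).coeFn_toLp, (memLp_comp_lipschitz hb g).coeFn_toLp]
    with x h1 h2 h3 h4
  rw [h1, h2, Pi.sub_apply, Pi.sub_apply, drift, drift, h3, h4]
  exact hb.norm_sub_le _ _

theorem norm_drift_le {b : ℝ → ℝ} {K : ℝ≥0} (hb : LipschitzWith K b) (f : L2O) :
    ‖drift hb f‖ ≤ |b 0| + K * ‖f‖ := by
  have h0 : ‖drift hb 0‖ ≤ |b 0| := by
    have : drift hb 0 = (memLp_const (b 0)).toLp (fun _ => b 0) := by
      refine MemLp.toLp_congr _ _ ?_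
      filter_upwards [Lp.coeFn_zero ℝ 2 (volume.restrict (Set.Ioo (0 : ℝ) 1))] with x hx
      exact congrArg b hx
    rw [this]
    refine (Lp.norm_toLp _ _).trans_le ?_
    rw [eLpNorm_const _ (by norm_num) (by simp)]
    simp
  calc ‖drift hb f‖ ≤ ‖drift hb 0‖ + ‖drift hb f - drift hb 0‖ := by
        simpa using norm_add_le (drift hb 0) (drift hb f - drift hb 0)
    _ ≤ |b 0| + K * ‖f‖ := by
        refine add_le_add h0 ?_
        simpa using norm_drift_sub_le hb f 0

theorem continuous_drift {b : ℝ → ℝ} {K : ℝ≥0} (hb : LipschitzWith K b) :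
    Continuous (drift hb) :=
  (LipschitzWith.of_dist_le_mul (K := K) fun f g => by
    simpa [dist_eq_norm] using norm_drift_sub_le hb f g).continuous

/-! ### Deterministic estimates along a path -/

/-- The constant of the integrated Gronwall inequality. -/
def gronwallConst (K : ℝ≥0) (T : ℝ) : ℝ≥0∞ := 2 * ENNReal.ofReal (Real.exp ((2 * K + 1) * T))

theorem lintegral_Ici_exp_neg_mul {β : ℝ} (hβ : 0 < β) (s : ℝ) :
    ∫⁻ t in Set.Ici s, ENNReal.ofReal (Real.exp (-β * t))
      = ENNReal.ofReal (Real.exp (-β * s)) * ENNReal.ofReal β⁻¹ := by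
  rw [← setLIntegral_congr Ioi_ae_eq_Ici, ← ofReal_integral_eq_lintegral_ofReal
    (integrableOn_exp_mul_Ioi (by linarith) s) (Filter.Eventually.of_forall fun t => by positivity),
    integral_exp_mul_Ioi (by linarith), ← ENNReal.ofReal_mul (by positivity)]
  congr 1
  field_simp

/-- Integrate against the weight `exp (-β t)` with `β = 2K + 1`. By Tonelli the Volterra term
contributes at most `K / β ≤ 1/2` of the weighted integral of `f`, which is absorbed on the left.
Removing the weight costs `exp (β T)`. -/
theorem lintegral_le_of_le_add_lintegral {T : ℝ} {K : ℝ≥0} {f a : ℝ → ℝ≥0∞}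
    (hf : AEMeasurable f (volume.restrict (Set.Icc 0 T)))
    (hfin : ∫⁻ s in Set.Icc 0 T, f s ≠ ∞)
    (h : ∀ t ∈ Set.Icc 0 T, f t ≤ a t + K * ∫⁻ s in Set.Icc 0 t, f s) :
    ∫⁻ t in Set.Icc 0 T, f t ≤ gronwallConst K T * ∫⁻ t in Set.Icc 0 T, a t := by
  set μ := (volume : Measure ℝ).restrict (Set.Icc 0 T) with hμ
  set β : ℝ := 2 * K + 1 with hβ
  have hβ0 : 0 < β := by positivity
  set w : ℝ → ℝ≥0∞ := fun t => ENNReal.ofReal (Real.exp (-β * t)) with hw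
  have hwm : Measurable w := by fun_prop
  -- The kernel of `s ≤ t` turns the variable upper limit into an integral over a fixed measure,
  -- ready for Tonelli.
  set ι : ℝ → ℝ → ℝ≥0∞ := fun t s => (Set.Iic t).indicator (fun _ => 1) s with hι
  have hιm : Measurable (Function.uncurry ι) := by
    have : Function.uncurry ι = {q : ℝ × ℝ | q.2 ≤ q.1}.indicator (fun _ => 1) := by
      funext q; simp only [Function.uncurry, ι, Set.indicator, Set.mem_Iic, Set.mem_ofPred_eq]
    rw [this]
    exact measurable_const.indicator (measurableSet_le measurable_snd measurable_fst)
  have hw1 : ∀ t ∈ Set.Icc 0 T, w t ≤ 1 := fun t ht => by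
    rw [hw, ENNReal.ofReal_le_one, Real.exp_le_one_iff]
    nlinarith [ht.1]
  set J := ∫⁻ t, w t * f t ∂μ with hJ
  have hJfin : J ≠ ∞ := by
    refine ne_top_of_le_ne_top hfin (setLIntegral_mono_ae' measurableSet_Icc
      (Filter.Eventually.of_forall fun t ht => ?_))
    exact (mul_le_mul_left (hw1 t ht) _).trans_eq (one_mul _)
  have hF : ∀ t ∈ Set.Icc 0 T, ∫⁻ s in Set.Icc 0 t, f s = ∫⁻ s, f s * ι t s ∂μ := by
    intro t ht
    have e1 : ∀ s, f s * ι t s = (Set.Iic t).indicator f s := fun s => by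
      simp only [ι, Set.indicator]; split_ifs <;> simp
    simp_rw [e1]
    rw [lintegral_indicator measurableSet_Iic, hμ, Measure.restrict_restrict measurableSet_Iic]
    congr 2
    ext s
    simp only [Set.mem_Icc, Set.mem_inter_iff, Set.mem_Iic]
    constructor
    · exact fun hs => ⟨hs.2, hs.1, hs.2.trans ht.2⟩
    · exact fun hs => ⟨hs.2.1, hs.1⟩
  have hswap : ∫⁻ t, w t * ∫⁻ s, f s * ι t s ∂μ ∂μ ≤ ENNReal.ofReal β⁻¹ * J := by
    have hprod : AEMeasurable (Function.uncurry fun t s => w t * (f s * ι t s)) (μ.prod μ) :=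
      (hwm.comp measurable_fst).aemeasurable.mul (hf.comp_snd.mul hιm.aemeasurable)
    have hin : ∀ t, w t * ∫⁻ s, f s * ι t s ∂μ = ∫⁻ s, w t * (f s * ι t s) ∂μ := fun t => by
      rw [lintegral_const_mul']
      exact ENNReal.ofReal_ne_top
    simp_rw [hin]
    rw [lintegral_lintegral_swap hprod, hJ, ← lintegral_const_mul' _ _ ENNReal.ofReal_ne_top]
    refine lintegral_mono fun s => ?_
    have hs : ∀ t, w t * (f s * ι t s) = f s * (Set.Ici s).indicator w t := fun t => by
      simp only [ι, Set.indicator, Set.mem_Iic, Set.mem_Ici]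
      split_ifs <;> simp [mul_comm]
    simp_rw [hs]
    calc ∫⁻ t, f s * (Set.Ici s).indicator w t ∂μ
        = f s * ∫⁻ t, (Set.Ici s).indicator w t ∂μ :=
          lintegral_const_mul _ (hwm.indicator measurableSet_Ici)
      _ ≤ f s * ∫⁻ t, (Set.Ici s).indicator w t := by
          gcongr
          exact Measure.restrict_le_self
      _ = ENNReal.ofReal β⁻¹ * (w s * f s) := by
          rw [lintegral_indicator measurableSet_Ici, lintegral_Ici_exp_neg_mul hβ0]
          ring
  have hKβ : (K : ℝ≥0∞) * ENNReal.ofReal β⁻¹ ≤ 2⁻¹ := by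
    rw [← ENNReal.ofReal_coe_nnreal, ← ENNReal.ofReal_mul (by positivity)]
    have h2 : (2⁻¹ : ℝ≥0∞) = ENNReal.ofReal 2⁻¹ := by
      rw [ENNReal.ofReal_inv_of_pos (by norm_num)]; simp
    rw [h2]
    refine ENNReal.ofReal_le_ofReal ?_
    rw [← div_eq_mul_inv, div_le_iff₀ hβ0]
    linarith
  have hmain : J ≤ ∫⁻ t, a t ∂μ + 2⁻¹ * J := by
    have hmeas : AEMeasurable (fun t => (K : ℝ≥0∞) * (w t * ∫⁻ s, f s * ι t s ∂μ)) μ := by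
      refine (hwm.aemeasurable.mul ?_).const_mul _
      exact (hf.comp_snd.mul hιm.aemeasurable).lintegral_prod_right'
    calc J ≤ ∫⁻ t, (a t + K * (w t * ∫⁻ s, f s * ι t s ∂μ)) ∂μ := by
          refine setLIntegral_mono_ae' measurableSet_Icc
            (Filter.Eventually.of_forall fun t ht => ?_)
          calc w t * f t ≤ w t * (a t + K * ∫⁻ s, f s * ι t s ∂μ) := by
                rw [← hF t ht]; exact mul_le_mul_right (h t ht) _
            _ ≤ 1 * a t + K * (w t * ∫⁻ s, f s * ι t s ∂μ) := by
                rw [mul_add]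
                refine add_le_add (mul_le_mul_left (hw1 t ht) _) (le_of_eq (by ring))
            _ = _ := by rw [one_mul]
      _ = ∫⁻ t, a t ∂μ + K * ∫⁻ t, w t * ∫⁻ s, f s * ι t s ∂μ ∂μ := by
          rw [lintegral_add_right' _ hmeas, lintegral_const_mul' _ _ ENNReal.coe_ne_top]
      _ ≤ ∫⁻ t, a t ∂μ + 2⁻¹ * J := by
          refine add_le_add le_rfl ?_
          calc (K : ℝ≥0∞) * ∫⁻ t, w t * ∫⁻ s, f s * ι t s ∂μ ∂μ
              ≤ K * (ENNReal.ofReal β⁻¹ * J) := mul_le_mul_right hswap _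
            _ = K * ENNReal.ofReal β⁻¹ * J := by ring
            _ ≤ 2⁻¹ * J := mul_le_mul_left hKβ _
  -- Absorption: half of `J` can be cancelled only because `J` is finite.
  have hJ2 : J ≤ 2 * ∫⁻ t, a t ∂μ := by
    have hhalf : 2⁻¹ * J + 2⁻¹ * J = J := by
      rw [← add_mul, ENNReal.inv_two_add_inv_two, one_mul]
    have hne : 2⁻¹ * J ≠ ∞ := ENNReal.mul_ne_top (by simp) hJfin
    have : 2⁻¹ * J ≤ ∫⁻ t, a t ∂μ := by
      rw [← ENNReal.add_le_add_iff_right hne, hhalf]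
      exact hmain
    calc J = 2 * (2⁻¹ * J) := by
          rw [← mul_assoc, ENNReal.mul_inv_cancel (by norm_num) (by norm_num), one_mul]
      _ ≤ _ := mul_le_mul_right this _
  calc ∫⁻ t, f t ∂μ ≤ ∫⁻ t, ENNReal.ofReal (Real.exp (β * T)) * (w t * f t) ∂μ := by
        refine setLIntegral_mono_ae' measurableSet_Icc
          (Filter.Eventually.of_forall fun t ht => ?_)
        rw [← mul_assoc, hw, ← ENNReal.ofReal_mul (by positivity), ← Real.exp_add]
        refine le_mul_of_one_le_left' ?_
        rw [ENNReal.one_le_ofReal, Real.one_le_exp_iff]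
        nlinarith [ht.2]
    _ = ENNReal.ofReal (Real.exp (β * T)) * J :=
        lintegral_const_mul' _ _ ENNReal.ofReal_ne_top
    _ ≤ ENNReal.ofReal (Real.exp (β * T)) * (2 * ∫⁻ t, a t ∂μ) := mul_le_mul_right hJ2 _
    _ = gronwallConst K T * ∫⁻ t, a t ∂μ := by rw [gronwallConst]; ring

/-- Duhamel's formula for the harmonic oscillator `y'' + r² y = f` in integrated form. -/
theorem duhamel_oscillator {T r y₁ : ℝ} (hr : r ≠ 0) {y f : ℝ → ℝ} {S : Set ℝ}
    (hS : S.Countable) (hy : ContinuousOn y (Set.Icc 0 T))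
    (hf : IntegrableOn f (Set.Icc 0 T)) (hfc : ∀ s ∈ Set.Ioo 0 T \ S, ContinuousAt f s)
    (hd : ∀ t ∈ Set.Ioc 0 T, HasDerivWithinAt y
      (y₁ + (∫ s in (0 : ℝ)..t, -(r ^ 2) * y s) + ∫ s in (0 : ℝ)..t, f s) (Set.Icc 0 T) t)
    {t : ℝ} (ht : t ∈ Set.Icc 0 T) :
    y t = Real.cos (r * t) * y 0 + Real.sin (r * t) / r * y₁
      + ∫ s in (0 : ℝ)..t, Real.sin (r * (t - s)) / r * f s := by
  set g : ℝ → ℝ := fun t => y₁ + (∫ s in (0 : ℝ)..t, -(r ^ 2) * y s) + ∫ s in (0 : ℝ)..t, f s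
    with hg
  have hT : 0 ≤ T := ht.1.trans ht.2
  have hyr : ContinuousOn (fun s => -(r ^ 2) * y s) (Set.Icc 0 T) := continuousOn_const.mul hy
  have hyi : IntegrableOn (fun s => -(r ^ 2) * y s) (Set.Icc 0 T) :=
    hyr.integrableOn_compact isCompact_Icc
  have hgc : ContinuousOn g (Set.Icc 0 T) := by
    have h1 := intervalIntegral.continuousOn_primitive_interval
      (f := f) (μ := volume) (a := 0) (b := T) (by rwa [Set.uIcc_of_le hT])
    have h2 := intervalIntegral.continuousOn_primitive_interval
      (f := fun s => -(r ^ 2) * y s) (μ := volume) (a := 0) (b := T) (by rwa [Set.uIcc_of_le hT])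
    rw [Set.uIcc_of_le hT] at h1 h2
    exact (continuousOn_const.add h2).add h1
  have hsub : Set.Icc 0 t ⊆ Set.Icc 0 T := Set.Icc_subset_Icc_right ht.2
  -- Since `y' = g` and, off `S`, `g' = -r² y + f`, the function `cos (r (t - s)) y s + sin (r (t -
  -- s)) / r · g s` has derivative `sin (r (t - s)) / r · f s` in `s`. Its values at `s = t` and `s
  -- = 0` are the two sides of the formula.
  have key := integral_eq_of_hasDerivAt_off_countable_of_le
    (fun s => Real.cos (r * (t - s)) * y s + Real.sin (r * (t - s)) / r * g s)
    (fun s => Real.sin (r * (t - s)) / r * f s) ht.1 hS ?_ ?_ ?_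
  · simp only [sub_self, mul_zero, Real.cos_zero, one_mul, Real.sin_zero, zero_div, zero_mul,
      add_zero, sub_zero] at key
    have hg0 : g 0 = y₁ := by simp [hg]
    rw [key, hg0]
    ring
  · exact ((by fun_prop : Continuous fun s => Real.cos (r * (t - s))).continuousOn.mul
      (hy.mono hsub)).add ((by fun_prop : Continuous fun s => Real.sin (r * (t - s)) / r
        ).continuousOn.mul (hgc.mono hsub))
  · rintro s ⟨⟨hs0, hst⟩, hsS⟩
    have hsT : s ∈ Set.Ioo 0 T := ⟨hs0, hst.trans_le ht.2⟩
    have hnhds : Set.Icc 0 T ∈ nhds s := Icc_mem_nhds hsT.1 hsT.2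
    have hyd : HasDerivAt y (g s) s := (hd s ⟨hsT.1, hsT.2.le⟩).hasDerivAt hnhds
    have hint : ∀ {F : ℝ → ℝ}, IntegrableOn F (Set.Icc 0 T) → ContinuousAt F s →
        HasDerivAt (fun u => ∫ x in (0 : ℝ)..u, F x) (F s) s := fun {F} hF hFc =>
      intervalIntegral.integral_hasDerivAt_right
        ((intervalIntegrable_iff_integrableOn_Icc_of_le hs0.le).2
          (hF.mono_set (Set.Icc_subset_Icc_right hsT.2.le)))
        (AEStronglyMeasurable.stronglyMeasurableAtFilter_of_mem hF.aestronglyMeasurable hnhds) hFc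
    have hgd : HasDerivAt g (-(r ^ 2) * y s + f s) s := by
      have := ((hint hyi (hyr.continuousAt hnhds)).const_add y₁).add (hint hf (hfc s ⟨hsT, hsS⟩))
      exact this
    have hlin : HasDerivAt (fun s => r * (t - s)) (-r) s := by
      simpa using ((hasDerivAt_id s).const_sub t).const_mul r
    have h := (hlin.cos.mul hyd).add ((hlin.sin.div_const r).mul hgd)
    convert! h using 1
    field_simp
    ring
  · rw [intervalIntegrable_iff_integrableOn_Icc_of_le ht.1]
    exact (hf.mono_set hsub).continuousOn_mul
      (by fun_prop : Continuous fun s => Real.sin (r * (t - s)) / r).continuousOn isCompact_Icc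

section Path

variable {T : ℝ} {f : ℝ → L2O}

theorem aestronglyMeasurable_greenOp {μ : Measure ℝ} (t : ℝ) (hf : AEStronglyMeasurable f μ) :
    AEStronglyMeasurable (fun s => greenOp (t - s) (f s)) μ := by
  have h : AEStronglyMeasurable (fun s => (t - s, f s)) μ :=
    (by fun_prop : Continuous fun s : ℝ => t - s).aestronglyMeasurable.prodMk hf
  have h2 := continuous_greenOp.comp_aestronglyMeasurable h
  exact h2

theorem intervalIntegrable_greenOp {t : ℝ} (ht : 0 ≤ t) (hf : IntegrableOn f (Set.Icc 0 t)) :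
    IntervalIntegrable (fun s => greenOp (t - s) (f s)) volume 0 t := by
  rw [intervalIntegrable_iff_integrableOn_Icc_of_le ht]
  exact Integrable.mono hf (aestronglyMeasurable_greenOp t hf.aestronglyMeasurable)
    (Filter.Eventually.of_forall fun s => norm_greenOp_le (t - s) (f s))

theorem inner_integral_greenOp {t : ℝ} (ht : 0 ≤ t) (hf : IntegrableOn f (Set.Icc 0 t)) (a : ℕ) :
    inner ℝ (eigvec a) (∫ s in (0 : ℝ)..t, greenOp (t - s) (f s))
      = ∫ s in (0 : ℝ)..t, Real.sin (Real.sqrt (eigval a) * (t - s)) / Real.sqrt (eigval a)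
          * inner ℝ (eigvec a) (f s) := by
  have h := (innerSL ℝ (eigvec a)).intervalIntegral_comp_comm (intervalIntegrable_greenOp ht hf)
  simp only [innerSL_apply_apply, inner_greenOp] at h
  exact h.symm

theorem enorm_intervalIntegral_le {E : Type*} [NormedAddCommGroup E] [NormedSpace ℝ E]
    {t : ℝ} (ht : 0 ≤ t) (F : ℝ → E) :
    ‖∫ s in (0 : ℝ)..t, F s‖ₑ ≤ ∫⁻ s in Set.Icc 0 t, ‖F s‖ₑ := by
  rw [intervalIntegral.integral_of_le ht]
  exact (enorm_integral_le_lintegral_enorm _).trans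
    (lintegral_mono' (Measure.restrict_mono Set.Ioc_subset_Icc_self le_rfl) le_rfl)

theorem integrableOn_drift {b : ℝ → ℝ} {K : ℝ≥0} (hb : LipschitzWith K b) {t : ℝ}
    (hf : IntegrableOn f (Set.Icc 0 t)) :
    IntegrableOn (fun s => drift hb (f s)) (Set.Icc 0 t) := by
  refine Integrable.mono' ((integrableOn_const (C := |b 0|) measure_Icc_lt_top.ne).add
      (hf.norm.const_mul (K : ℝ)))
    ((continuous_drift hb).comp_aestronglyMeasurable hf.aestronglyMeasurable)
    (Filter.Eventually.of_forall fun s => norm_drift_le hb _)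

theorem enorm_drift_le {b : ℝ → ℝ} {K : ℝ≥0} (hb : LipschitzWith K b) (g : L2O) :
    ‖drift hb g‖ₑ ≤ ENNReal.ofReal |b 0| + K * ‖g‖ₑ := by
  rw [← ofReal_norm, ← ofReal_norm, ← ENNReal.ofReal_coe_nnreal,
    ← ENNReal.ofReal_mul (by positivity), ← ENNReal.ofReal_add (by positivity) (by positivity)]
  exact ENNReal.ofReal_le_ofReal (norm_drift_le hb g)

theorem tailProj_integral_greenOp (N : ℕ) {t : ℝ} (ht : 0 ≤ t)
    (hf : IntegrableOn f (Set.Icc 0 t)) :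
    tailProj N (∫ s in (0 : ℝ)..t, greenOp (t - s) (f s))
      = ∫ s in (0 : ℝ)..t, tailProj N (greenOp (t - s) (f s)) :=
  ((tailProj N).intervalIntegral_comp_comm (intervalIntegrable_greenOp ht hf)).symm

theorem tailProj_zero_integral_greenOp {t : ℝ} (ht : 0 ≤ t)
    (hf : IntegrableOn f (Set.Icc 0 t)) :
    tailProj 0 (∫ s in (0 : ℝ)..t, greenOp (t - s) (f s))
      = ∫ s in (0 : ℝ)..t, greenOp (t - s) (f s) := by
  rw [tailProj_integral_greenOp 0 ht hf]
  simp_rw [tailProj_zero_greenOp]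

variable {b : ℝ → ℝ} {K : ℝ≥0} (hb : LipschitzWith K b) {u₀ v₀ : L2O} {η u : ℝ → L2O} {t : ℝ}

/-- Every term of the mild formula lies in the closed span of the eigenfunctions. This replaces the
completeness of the sine system. -/
theorem tailProj_zero_of_mild (ht : 0 ≤ t) (hη : IntegrableOn η (Set.Icc 0 t))
    (hu : IntegrableOn u (Set.Icc 0 t))
    (hmild : u t = greenOp t v₀ + greenDerivOp t u₀
      + (∫ s in (0 : ℝ)..t, greenOp (t - s) (drift hb (u s)))
      + ∫ s in (0 : ℝ)..t, greenOp (t - s) (η s)) :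
    tailProj 0 (u t) = u t := by
  rw [hmild, map_add, map_add, map_add, tailProj_zero_greenOp, tailProj_zero_greenDerivOp,
    tailProj_zero_integral_greenOp ht hη, tailProj_zero_integral_greenOp ht
      (integrableOn_drift hb hu)]

/-- The noise term is left as it is: estimating it by the pathwise norm of the regularized noise
would bring in a negative power of the time step. -/
theorem enorm_tailProj_le_of_mild (N : ℕ) (ht : 0 ≤ t)
    (hu : IntegrableOn u (Set.Icc 0 t))
    (hmild : u t = greenOp t v₀ + greenDerivOp t u₀
      + (∫ s in (0 : ℝ)..t, greenOp (t - s) (drift hb (u s)))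
      + ∫ s in (0 : ℝ)..t, greenOp (t - s) (η s)) :
    ‖tailProj N (u t)‖ₑ ≤ ENNReal.ofReal ((N : ℝ) + 1)⁻¹ * (‖v₀‖ₑ + hdotNorm 1 u₀
        + ∫⁻ s in Set.Icc 0 t, (ENNReal.ofReal |b 0| + K * ‖u s‖ₑ))
      + ‖tailProj N (∫ s in (0 : ℝ)..t, greenOp (t - s) (η s))‖ₑ := by
  have hg : ∀ r g, ‖tailProj N (greenOp r g)‖ₑ ≤ ENNReal.ofReal ((N : ℝ) + 1)⁻¹ * ‖g‖ₑ := by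
    intro r g
    rw [← ofReal_norm, ← ofReal_norm, ← ENNReal.ofReal_mul (by positivity)]
    exact ENNReal.ofReal_le_ofReal (norm_tailProj_greenOp_le N r g)
  have hdr : ‖tailProj N (∫ s in (0 : ℝ)..t, greenOp (t - s) (drift hb (u s)))‖ₑ
      ≤ ENNReal.ofReal ((N : ℝ) + 1)⁻¹
        * ∫⁻ s in Set.Icc 0 t, (ENNReal.ofReal |b 0| + K * ‖u s‖ₑ) := by
    rw [tailProj_integral_greenOp N ht (integrableOn_drift hb hu),
      ← lintegral_const_mul' _ _ ENNReal.ofReal_ne_top]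
    refine (enorm_intervalIntegral_le ht _).trans (lintegral_mono fun s => ?_)
    exact (hg _ _).trans (mul_le_mul_right (enorm_drift_le hb _) _)
  rw [hmild, map_add, map_add, map_add, mul_add, mul_add]
  refine (enorm_add_le _ _).trans (add_le_add ?_ le_rfl)
  refine (enorm_add_le _ _).trans (add_le_add ?_ hdr)
  exact (enorm_add_le _ _).trans (add_le_add (hg _ _) (enorm_tailProj_greenDerivOp_le N t u₀))

variable {uN : ℝ → L2O} {N : ℕ} {S : Set ℝ}

/-- The modes of the spectral Galerkin approximation are given by the variation of constants
formula. -/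
theorem inner_galerkin_eq (hS : S.Countable)
    (hη : IntegrableOn η (Set.Icc 0 T)) (hηc : ∀ s ∈ Set.Ioo 0 T \ S, ContinuousAt η s)
    (hc : ContinuousOn uN (Set.Icc 0 T)) (h0 : uN 0 = galerkinProj N u₀)
    (hd : ∀ t ∈ Set.Ioc 0 T, ∃ w : L2O, HasDerivWithinAt uN w (Set.Icc 0 T) t ∧
      ∀ v ∈ galerkinSpace N, inner ℝ w v = inner ℝ (galerkinProj N v₀) v
          + (∫ s in (0 : ℝ)..t, inner ℝ (uN s) (laplacian v))
          + ∫ s in (0 : ℝ)..t, inner ℝ (drift hb (uN s) + η s) v)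
    (ht : t ∈ Set.Icc 0 T) {a : ℕ} (ha : a < N) :
    inner ℝ (eigvec a) (uN t) = Real.cos (Real.sqrt (eigval a) * t) * inner ℝ (eigvec a) u₀
      + Real.sin (Real.sqrt (eigval a) * t) / Real.sqrt (eigval a) * inner ℝ (eigvec a) v₀
      + ∫ s in (0 : ℝ)..t, Real.sin (Real.sqrt (eigval a) * (t - s)) / Real.sqrt (eigval a)
          * inner ℝ (eigvec a) (drift hb (uN s) + η s) := by
  have hcd : ContinuousOn (fun s => drift hb (uN s)) (Set.Icc 0 T) :=
    (continuous_drift hb).comp_continuousOn hc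
  have hi : IntegrableOn (fun s => drift hb (uN s) + η s) (Set.Icc 0 T) :=
    (hcd.integrableOn_compact isCompact_Icc).add hη
  -- Tested with the eigenfunction of index `a`, the Galerkin equation is a scalar oscillator of
  -- frequency `√λ_a`.
  have h := duhamel_oscillator (T := T) (r := Real.sqrt (eigval a))
    (y₁ := inner ℝ (eigvec a) (galerkinProj N v₀)) (sqrt_eigval_pos a).ne'
    (y := fun s => inner ℝ (eigvec a) (uN s))
    (f := fun s => inner ℝ (eigvec a) (drift hb (uN s) + η s)) hS
    (continuousOn_const.inner hc) (hi.const_inner _) ?_ ?_ ht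
  · simpa only [h0, inner_galerkinProj ha] using h
  · intro s hs
    exact continuousAt_const.inner ((hcd.continuousAt (Icc_mem_nhds hs.1.1 hs.1.2)).add
      (hηc s hs))
  · intro τ hτ
    obtain ⟨w, hw, hwv⟩ := hd τ hτ
    have h1 := hwv _ (eigvec_mem_galerkinSpace ha)
    have h2 : ∀ s, inner ℝ (uN s) (laplacian (eigvec a))
        = -(Real.sqrt (eigval a) ^ 2) * inner ℝ (eigvec a) (uN s) := fun s => by
      rw [laplacian_eigvec, inner_smul_right, real_inner_comm,
        Real.sq_sqrt (by unfold eigval; positivity)]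
    have h3 : ∀ s, inner ℝ (drift hb (uN s) + η s) (eigvec a)
        = inner ℝ (eigvec a) (drift hb (uN s) + η s) := fun s => real_inner_comm _ _
    simp_rw [h2, h3] at h1
    rw [real_inner_comm, real_inner_comm (eigvec a) (galerkinProj N v₀)] at h1
    rw [← h1]
    have h4 := ((hasDerivWithinAt_const τ (Set.Icc 0 T) (eigvec a)).inner ℝ hw)
    simpa using h4

/-- Both functions satisfy the same variation of constants formula in each mode below `N`, so data
and noise cancel exactly. -/
theorem headProj_sub_galerkin_eq (hS : S.Countable)
    (hη : IntegrableOn η (Set.Icc 0 T)) (hηc : ∀ s ∈ Set.Ioo 0 T \ S, ContinuousAt η s)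
    (hu : IntegrableOn u (Set.Icc 0 T))
    (hc : ContinuousOn uN (Set.Icc 0 T)) (h0 : uN 0 = galerkinProj N u₀)
    (hd : ∀ t ∈ Set.Ioc 0 T, ∃ w : L2O, HasDerivWithinAt uN w (Set.Icc 0 T) t ∧
      ∀ v ∈ galerkinSpace N, inner ℝ w v = inner ℝ (galerkinProj N v₀) v
          + (∫ s in (0 : ℝ)..t, inner ℝ (uN s) (laplacian v))
          + ∫ s in (0 : ℝ)..t, inner ℝ (drift hb (uN s) + η s) v)
    (ht : t ∈ Set.Icc 0 T)
    (hmild : u t = greenOp t v₀ + greenDerivOp t u₀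
      + (∫ s in (0 : ℝ)..t, greenOp (t - s) (drift hb (u s)))
      + ∫ s in (0 : ℝ)..t, greenOp (t - s) (η s)) :
    headProj N (u t - uN t)
      = headProj N (∫ s in (0 : ℝ)..t, greenOp (t - s) (drift hb (u s) - drift hb (uN s))) := by
  refine headProj_congr fun a ha => ?_
  have hsub : Set.Icc 0 t ⊆ Set.Icc 0 T := Set.Icc_subset_Icc_right ht.2
  have hη' := hη.mono_set hsub
  have hdu := integrableOn_drift hb (hu.mono_set hsub)
  have hdN := integrableOn_drift hb ((hc.integrableOn_compact isCompact_Icc).mono_set hsub)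
  have hdη : IntegrableOn (fun s => drift hb (uN s) + η s) (Set.Icc 0 t) := hdN.add hη'
  have e3 := inner_integral_greenOp ht.1 hdη a
  have e4 : ∫ s in (0 : ℝ)..t, greenOp (t - s) (drift hb (u s) - drift hb (uN s))
      = (∫ s in (0 : ℝ)..t, greenOp (t - s) (drift hb (u s)))
        + (∫ s in (0 : ℝ)..t, greenOp (t - s) (η s))
        - ∫ s in (0 : ℝ)..t, greenOp (t - s) (drift hb (uN s) + η s) := by
    rw [← intervalIntegral.integral_add (intervalIntegrable_greenOp ht.1 hdu)
      (intervalIntegrable_greenOp ht.1 hη'), ← intervalIntegral.integral_sub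
      ((intervalIntegrable_greenOp ht.1 hdu).add (intervalIntegrable_greenOp ht.1 hη'))
      (intervalIntegrable_greenOp ht.1 hdη)]
    refine intervalIntegral.integral_congr fun s _ => ?_
    have hadd : ∀ f g, greenOp (t - s) (f + g) = greenOp (t - s) f + greenOp (t - s) g :=
      fun f g => map_add (diagCLM orthonormal_eigvec zero_le_one (abs_green_coeff_le_one (t - s)))
        f g
    simp only [hadd, greenOp_sub]
    abel
  rw [e4, inner_sub_right, inner_sub_right, inner_add_right, e3, hmild, inner_add_right,
    inner_add_right, inner_add_right, inner_greenOp, inner_greenDerivOp,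
    inner_galerkin_eq hb hS hη hηc hc h0 hd ht ha]
  ring

/-- Split `u t` into head and tail. The head of the error is a drift convolution, and the head
projection and the Green operator are both contractions, so only the Lipschitz constant `K` appears.
-/
theorem enorm_sub_galerkin_le (hS : S.Countable)
    (hη : IntegrableOn η (Set.Icc 0 T)) (hηc : ∀ s ∈ Set.Ioo 0 T \ S, ContinuousAt η s)
    (hu : IntegrableOn u (Set.Icc 0 T))
    (hc : ContinuousOn uN (Set.Icc 0 T)) (h0 : uN 0 = galerkinProj N u₀)
    (hd : ∀ t ∈ Set.Ioc 0 T, ∃ w : L2O, HasDerivWithinAt uN w (Set.Icc 0 T) t ∧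
      ∀ v ∈ galerkinSpace N, inner ℝ w v = inner ℝ (galerkinProj N v₀) v
          + (∫ s in (0 : ℝ)..t, inner ℝ (uN s) (laplacian v))
          + ∫ s in (0 : ℝ)..t, inner ℝ (drift hb (uN s) + η s) v)
    (ht : t ∈ Set.Icc 0 T) (hmem : uN t ∈ galerkinSpace N)
    (hmild : u t = greenOp t v₀ + greenDerivOp t u₀
      + (∫ s in (0 : ℝ)..t, greenOp (t - s) (drift hb (u s)))
      + ∫ s in (0 : ℝ)..t, greenOp (t - s) (η s)) :
    ‖u t - uN t‖ₑ ≤ ‖tailProj N (u t)‖ₑ + K * ∫⁻ s in Set.Icc 0 t, ‖u s - uN s‖ₑ := by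
  have hsub : Set.Icc 0 t ⊆ Set.Icc 0 T := Set.Icc_subset_Icc_right ht.2
  have h1 : u t - uN t = tailProj N (u t)
      + headProj N (∫ s in (0 : ℝ)..t, greenOp (t - s) (drift hb (u s) - drift hb (uN s))) := by
    rw [← headProj_sub_galerkin_eq hb hS hη hηc hu hc h0 hd ht hmild, map_sub,
      headProj_of_mem hmem]
    conv_lhs => rw [← tailProj_zero_of_mild hb ht.1 (hη.mono_set hsub) (hu.mono_set hsub) hmild,
      ← headProj_add_tailProj N]
    abel
  rw [h1]
  refine (enorm_add_le _ _).trans (add_le_add le_rfl ?_)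
  rw [← lintegral_const_mul' _ _ ENNReal.coe_ne_top]
  calc _ ≤ ‖∫ s in (0 : ℝ)..t, greenOp (t - s) (drift hb (u s) - drift hb (uN s))‖ₑ :=
        enorm_le_iff_norm_le.2 (norm_headProj_le N _)
    _ ≤ _ := enorm_intervalIntegral_le ht.1 _
    _ ≤ _ := lintegral_mono fun s => by
        refine (enorm_le_iff_norm_le.2 (norm_greenOp_le _ _)).trans ?_
        rw [← ofReal_norm, ← ofReal_norm, ← ENNReal.ofReal_coe_nnreal,
          ← ENNReal.ofReal_mul (by positivity)]
        exact ENNReal.ofReal_le_ofReal (norm_drift_sub_le hb _ _)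

end Path

/-! ### `L^p` norms of nonnegative random variables -/

section LpNorm

variable {Ω : Type*} [MeasurableSpace Ω] {μ : Measure Ω} {p : ℝ}

/-- The `L^p` norm of a `[0,∞]`-valued function. -/
def lpNorm (p : ℝ) (μ : Measure Ω) (f : Ω → ℝ≥0∞) : ℝ≥0∞ := (∫⁻ ω, f ω ^ p ∂μ) ^ (1 / p)

theorem lpNorm_mono_ae (hp : 0 < p) {f g : Ω → ℝ≥0∞} (h : ∀ᵐ ω ∂μ, f ω ≤ g ω) :
    lpNorm p μ f ≤ lpNorm p μ g := by
  refine ENNReal.rpow_le_rpow (lintegral_mono_ae ?_) (by positivity)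
  filter_upwards [h] with ω hω
  exact ENNReal.rpow_le_rpow hω hp.le

theorem lpNorm_add_le (hp : 1 ≤ p) {f g : Ω → ℝ≥0∞} (hf : AEMeasurable f μ)
    (hg : AEMeasurable g μ) :
    lpNorm p μ (fun ω => f ω + g ω) ≤ lpNorm p μ f + lpNorm p μ g :=
  ENNReal.lintegral_Lp_add_le hf hg hp

theorem lpNorm_const_mul (hp : 0 < p) {c : ℝ≥0∞} (hc : c ≠ ∞) (f : Ω → ℝ≥0∞) :
    lpNorm p μ (fun ω => c * f ω) = c * lpNorm p μ f := by
  simp_rw [lpNorm, ENNReal.mul_rpow_of_nonneg _ _ hp.le]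
  rw [lintegral_const_mul' _ _ (ENNReal.rpow_ne_top_of_nonneg hp.le hc),
    ENNReal.mul_rpow_of_nonneg _ _ (by positivity), ← ENNReal.rpow_mul,
    mul_one_div_cancel hp.ne', ENNReal.rpow_one]

theorem lpNorm_const [IsProbabilityMeasure μ] (hp : 0 < p) (c : ℝ≥0∞) :
    lpNorm p μ (fun _ => c) = c := by
  rw [lpNorm, lintegral_const, measure_univ, mul_one, ← ENNReal.rpow_mul,
    mul_one_div_cancel hp.ne', ENNReal.rpow_one]

theorem lpNorm_zero (hp : 0 < p) : lpNorm p μ (fun _ => 0) = 0 := by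
  simp [lpNorm, ENNReal.zero_rpow_of_pos hp, hp]

theorem lpNorm_sum_le (hp : 1 ≤ p) {f : ℕ → Ω → ℝ≥0∞} (hf : ∀ a, AEMeasurable (f a) μ) (M : ℕ) :
    lpNorm p μ (fun ω => ∑ a ∈ Finset.range M, f a ω)
      ≤ ∑ a ∈ Finset.range M, lpNorm p μ (f a) := by
  induction M with
  | zero => simpa using (lpNorm_zero (μ := μ) (by linarith : 0 < p)).le
  | succ M ih =>
    simp_rw [Finset.sum_range_succ]
    exact (lpNorm_add_le hp (Finset.aemeasurable_fun_sum _ fun a _ => hf a) (hf M)).trans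
      (add_le_add ih le_rfl)

/-- Monotone convergence applied to the partial sums, for which Minkowski's inequality holds. -/
theorem lpNorm_tsum_le (hp : 1 ≤ p) {f : ℕ → Ω → ℝ≥0∞} (hf : ∀ a, AEMeasurable (f a) μ) :
    lpNorm p μ (fun ω => ∑' a, f a ω) ≤ ∑' a, lpNorm p μ (f a) := by
  have hp0 : 0 < p := by linarith
  have hmono : ∀ ω, Monotone fun M => ∑ a ∈ Finset.range M, f a ω := fun ω M M' h =>
    Finset.sum_le_sum_of_subset (Finset.range_mono h)
  have hsup : ∀ ω, (∑' a, f a ω) ^ p = ⨆ M, (∑ a ∈ Finset.range M, f a ω) ^ p := fun ω => by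
    rw [ENNReal.tsum_eq_iSup_nat]
    exact (ENNReal.orderIsoRpow p hp0).map_iSup _
  rw [lpNorm]
  simp_rw [hsup]
  rw [lintegral_iSup' (fun M => (Finset.aemeasurable_fun_sum _ fun a _ => hf a).pow_const p)
    (Filter.Eventually.of_forall fun ω M M' h => ENNReal.rpow_le_rpow (hmono ω h) hp0.le),
    show (⨆ M, ∫⁻ ω, (∑ a ∈ Finset.range M, f a ω) ^ p ∂μ) ^ (1 / p)
      = ⨆ M, (∫⁻ ω, (∑ a ∈ Finset.range M, f a ω) ^ p ∂μ) ^ (1 / p) from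
      (ENNReal.orderIsoRpow (1 / p) (by positivity)).map_iSup _]
  exact iSup_le fun M => (lpNorm_sum_le hp hf M).trans (ENNReal.sum_le_tsum _)

/-- Minkowski's inequality for a time integral, with a uniform bound on the time slices. -/
theorem lpNorm_lintegral_Icc_le {T : ℝ} [SFinite μ] (hp : 1 < p)
    {z : ℝ → Ω → ℝ≥0∞} {B : ℝ≥0∞}
    (hz : AEMeasurable (fun q : Ω × ℝ => z q.2 q.1) (μ.prod (volume.restrict (Set.Icc 0 T))))
    (hB : ∀ t ∈ Set.Icc 0 T, lpNorm p μ (z t) ≤ B) :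
    lpNorm p μ (fun ω => ∫⁻ t in Set.Icc 0 T, z t ω) ≤ ENNReal.ofReal T * B := by
  have hp0 : 0 < p := by linarith
  set ν := (volume : Measure ℝ).restrict (Set.Icc 0 T) with hν
  have hν1 : ν Set.univ = ENNReal.ofReal T := by simp [hν]
  -- Hölder against the constant 1, whose conjugate norm accounts for the power `p - 1` of `T`;
  -- Tonelli then exchanges time and probability.
  have hslice : ∀ᵐ ω ∂μ, (∫⁻ t, z t ω ∂ν) ^ p
      ≤ ENNReal.ofReal T ^ (p - 1) * ∫⁻ t, z t ω ^ p ∂ν := by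
    filter_upwards [hz.aestronglyMeasurable.prodMk_left] with ω hω
    have hq := Real.HolderConjugate.conjExponent hp
    have h := ENNReal.lintegral_mul_le_Lp_mul_Lq ν hq hω.aemeasurable
      (aemeasurable_const (b := (1 : ℝ≥0∞)))
    simp only [Pi.mul_apply, mul_one, ENNReal.one_rpow, lintegral_const, one_mul, hν1] at h
    refine (ENNReal.rpow_le_rpow h hp0.le).trans_eq ?_
    rw [ENNReal.mul_rpow_of_nonneg _ _ hp0.le, ← ENNReal.rpow_mul, ← ENNReal.rpow_mul,
      one_div_mul_cancel hp0.ne', ENNReal.rpow_one, mul_comm, one_div_mul_eq_div,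
      hq.div_conj_eq_sub_one]
  have hpow : ∫⁻ ω, (∫⁻ t, z t ω ∂ν) ^ p ∂μ ≤ (ENNReal.ofReal T * B) ^ p := by
    calc ∫⁻ ω, (∫⁻ t, z t ω ∂ν) ^ p ∂μ
        ≤ ∫⁻ ω, ENNReal.ofReal T ^ (p - 1) * ∫⁻ t, z t ω ^ p ∂ν ∂μ := lintegral_mono_ae hslice
      _ = ENNReal.ofReal T ^ (p - 1) * ∫⁻ t, ∫⁻ ω, z t ω ^ p ∂μ ∂ν := by
          rw [lintegral_const_mul' _ _
            (ENNReal.rpow_ne_top_of_nonneg (by linarith) ENNReal.ofReal_ne_top),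
            lintegral_lintegral_swap (hz.pow_const p)]
      _ ≤ ENNReal.ofReal T ^ (p - 1) * ∫⁻ _, B ^ p ∂ν := by
          refine mul_le_mul_right (setLIntegral_mono_ae' measurableSet_Icc
            (Filter.Eventually.of_forall fun t ht => ?_)) _
          have h := ENNReal.rpow_le_rpow (hB t ht) hp0.le
          rwa [lpNorm, ← ENNReal.rpow_mul, one_div_mul_cancel hp0.ne', ENNReal.rpow_one] at h
      _ = (ENNReal.ofReal T * B) ^ p := by
          rw [lintegral_const, hν1, ENNReal.mul_rpow_of_nonneg _ _ hp0.le, mul_comm (B ^ p),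
            ← mul_assoc]
          congr 1
          conv_lhs => rw [← ENNReal.rpow_one (ENNReal.ofReal T)]
          rw [← ENNReal.rpow_mul, one_mul, ← ENNReal.rpow_add_of_nonneg _ _ (by linarith)
            zero_le_one, sub_add_cancel]
  refine (ENNReal.rpow_le_rpow hpow (by positivity : 0 ≤ 1 / p)).trans_eq ?_
  rw [← ENNReal.rpow_mul, mul_one_div_cancel hp0.ne', ENNReal.rpow_one]

end LpNorm

/-! ### Moments of centred Gaussian variables -/

/-- The absolute moment of order `p` of the standard Gaussian. -/
def gaussMoment (p : ℝ) : ℝ≥0∞ := ∫⁻ x, ‖x‖ₑ ^ p ∂(gaussianReal 0 1)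

theorem gaussMoment_lt_top {p : ℝ} (hp : 0 < p) : gaussMoment p < ∞ := by
  have h := (memLp_id_gaussianReal' (μ := 0) (v := 1) (ENNReal.ofReal p) (by simp)).2
  rw [eLpNorm_lt_top_iff_lintegral_rpow_enorm_lt_top (by simpa using hp) (by simp)] at h
  simpa [gaussMoment, ENNReal.toReal_ofReal hp.le] using h

/-- The variable has the law of its standard deviation times a standard Gaussian. A bound `v`
replaces the variance because only upper bounds are available for the noise modes. -/
theorem lintegral_rpow_le_of_gaussian {Ω : Type*} [MeasurableSpace Ω] {P : Measure Ω}
    {X : Ω → ℝ} (hX : HasGaussianLaw X P) (h0 : ∫ ω, X ω ∂P = 0) {v p : ℝ} (hp : 0 < p)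
    (hv : ∫ ω, X ω ^ 2 ∂P ≤ v) :
    ∫⁻ ω, ‖X ω‖ₑ ^ p ∂P ≤ gaussMoment p * ENNReal.ofReal v ^ (p / 2) := by
  have := hX.isProbabilityMeasure
  set σ2 := Var[X; P].toNNReal with hσ
  have hvar : Var[X; P] = ∫ ω, X ω ^ 2 ∂P := variance_of_integral_eq_zero hX.aemeasurable h0
  have hmap : P.map X = (gaussianReal 0 1).map (fun x => Real.sqrt σ2 * x) := by
    rw [hX.map_eq_gaussianReal, h0, gaussianReal_map_const_mul]
    congr 1
    · simp
    · ext
      simp [hσ]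
  have h1 : ∫⁻ ω, ‖X ω‖ₑ ^ p ∂P = ∫⁻ x, ‖x‖ₑ ^ p ∂(P.map X) :=
    
    (lintegral_map' (f := fun x : ℝ => ‖x‖ₑ ^ p) (by fun_prop) hX.aemeasurable).symm
  rw [h1, hmap, lintegral_map (by fun_prop) (by fun_prop)]
  simp_rw [enorm_mul, ENNReal.mul_rpow_of_nonneg _ _ hp.le]
  rw [lintegral_const_mul' _ _ (ENNReal.rpow_ne_top_of_nonneg hp.le (by simp)), mul_comm,
    gaussMoment]
  gcongr
  have h2 : ‖Real.sqrt σ2‖ₑ = ENNReal.ofReal σ2 ^ (1 / 2 : ℝ) := by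
    rw [Real.enorm_eq_ofReal (Real.sqrt_nonneg _), Real.sqrt_eq_rpow,
      ENNReal.ofReal_rpow_of_nonneg (by positivity) (by norm_num)]
  rw [h2, ← ENNReal.rpow_mul, one_div_mul_eq_div]
  refine ENNReal.rpow_le_rpow (ENNReal.ofReal_le_ofReal ?_) (by positivity)
  rw [hσ, Real.coe_toNNReal _ (variance_nonneg _ _), hvar]
  exact hv

/-- The `L^p` norm of an `ℓ²` norm of centred Gaussian variables. -/
theorem lpNorm_l2_le_of_gaussian {Ω : Type*} [MeasurableSpace Ω] {P : Measure Ω}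
    {X : ℕ → Ω → ℝ} (hX : ∀ a, HasGaussianLaw (X a) P) (h0 : ∀ a, ∫ ω, X a ω ∂P = 0)
    {v : ℕ → ℝ} {p : ℝ} (hp : 2 ≤ p) (hv : ∀ a, ∫ ω, X a ω ^ 2 ∂P ≤ v a) :
    lpNorm p P (fun ω => (∑' a, ENNReal.ofReal (X a ω ^ 2)) ^ (1 / 2 : ℝ))
      ≤ gaussMoment p ^ (1 / p) * (∑' a, ENNReal.ofReal (v a)) ^ (1 / 2 : ℝ) := by
  have hp0 : 0 < p := by linarith
  have hq : 1 ≤ p / 2 := by linarith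
  have hq0 : 0 < p / 2 := by linarith
  -- Passing to `L^(p/2)` of the sum of squares allows the triangle inequality mode by mode; this is
  -- where `p ≥ 2` enters.
  have e1 : lpNorm p P (fun ω => (∑' a, ENNReal.ofReal (X a ω ^ 2)) ^ (1 / 2 : ℝ))
      = lpNorm (p / 2) P (fun ω => ∑' a, ENNReal.ofReal (X a ω ^ 2)) ^ (1 / 2 : ℝ) := by
    simp_rw [lpNorm, ← ENNReal.rpow_mul]
    congr 2
    · simp_rw [one_div_mul_eq_div]
    · field_simp
  have hm : ∀ a, AEMeasurable (fun ω => ENNReal.ofReal (X a ω ^ 2)) P := fun a =>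
    ((hX a).aemeasurable.pow_const 2).ennreal_ofReal
  have e2 : ∀ a, lpNorm (p / 2) P (fun ω => ENNReal.ofReal (X a ω ^ 2))
      ≤ gaussMoment p ^ (2 / p) * ENNReal.ofReal (v a) := fun a => by
    have h := lintegral_rpow_le_of_gaussian (hX a) (h0 a) hp0 (hv a)
    have e3 : ∀ ω, ENNReal.ofReal (X a ω ^ 2) ^ (p / 2) = ‖X a ω‖ₑ ^ p := fun ω => by
      rw [← sq_abs, ← Real.norm_eq_abs, ENNReal.ofReal_pow (norm_nonneg _), ofReal_norm,
        ← ENNReal.rpow_natCast, ← ENNReal.rpow_mul]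
      congr 1
      push_cast
      ring
    rw [lpNorm]
    simp_rw [e3]
    refine (ENNReal.rpow_le_rpow h (by positivity)).trans_eq ?_
    rw [ENNReal.mul_rpow_of_nonneg _ _ (by positivity), ← ENNReal.rpow_mul,
      mul_one_div_cancel hq0.ne', ENNReal.rpow_one, one_div_div]
  rw [e1]
  calc _ ≤ (∑' a, gaussMoment p ^ (2 / p) * ENNReal.ofReal (v a)) ^ (1 / 2 : ℝ) :=
        ENNReal.rpow_le_rpow ((lpNorm_tsum_le hq hm).trans (ENNReal.tsum_le_tsum e2))
          (by norm_num)
    _ = _ := by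
        rw [ENNReal.tsum_mul_left, ENNReal.mul_rpow_of_nonneg _ _ (by norm_num),
          ← ENNReal.rpow_mul]
        congr 2
        field_simp

/-! ### Correlation of the increments of fractional Brownian motion -/

section Correlation

variable {s : ℝ}

/-- The correlation of the `j`-th and `l`-th unit increments of a fractional Brownian motion with
Hurst index `s / 2`. -/
def incrCorr (s : ℝ) (j l : ℕ) : ℝ :=
  (|(j : ℝ) + 1 - l| ^ s + |(j : ℝ) - (l + 1)| ^ s - 2 * |(j : ℝ) - l| ^ s) / 2

theorem incrCorr_self (hs : 0 < s) (j : ℕ) : incrCorr s j j = 1 := by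
  simp [incrCorr, Real.zero_rpow hs.ne']

theorem incrCorr_comm (s : ℝ) (j l : ℕ) : incrCorr s j l = incrCorr s l j := by
  rw [incrCorr, incrCorr, abs_sub_comm ((j : ℝ) + 1), abs_sub_comm (j : ℝ), abs_sub_comm (j : ℝ)]
  ring

/-- Midpoint concavity of `x ↦ x ^ s` at `d - 1`, `d`, `d + 1` with `d = j - l ≥ 1`. -/
theorem incrCorr_nonpos_of_lt (hs : 0 < s) (hs1 : s ≤ 1) {j l : ℕ} (h : l < j) :
    incrCorr s j l ≤ 0 := by
  have hd : (1 : ℝ) ≤ (j : ℝ) - l := by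
    have : (l : ℝ) + 1 ≤ j := by exact_mod_cast h
    linarith
  obtain ⟨-, hconc⟩ := Real.concaveOn_rpow hs.le hs1
  have hc := @hconc ((j : ℝ) - l + 1) (Set.mem_Ici.2 (by linarith)) ((j : ℝ) - l - 1)
    (Set.mem_Ici.2 (by linarith)) (1 / 2) (1 / 2) (by norm_num) (by norm_num) (by norm_num)
  simp only [smul_eq_mul] at hc
  rw [show 1 / 2 * ((j : ℝ) - l + 1) + 1 / 2 * ((j : ℝ) - l - 1) = (j : ℝ) - l by ring] at hc
  rw [incrCorr, abs_of_nonneg (by linarith), abs_of_nonneg (by linarith),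
    abs_of_nonneg (by linarith), show (j : ℝ) + 1 - l = (j : ℝ) - l + 1 by ring,
    show (j : ℝ) - (l + 1) = (j : ℝ) - l - 1 by ring]
  linarith

theorem incrCorr_nonpos (hs : 0 < s) (hs1 : s ≤ 1) {j l : ℕ} (h : l ≠ j) :
    incrCorr s j l ≤ 0 := by
  rcases lt_or_gt_of_ne h with h | h
  · exact incrCorr_nonpos_of_lt hs hs1 h
  · rw [incrCorr_comm]; exact incrCorr_nonpos_of_lt hs hs1 h

/-- The sum telescopes to half of `(j+1)^s - j^s + (n-j)^s - (n-j-1)^s`, and powers are monotone. -/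
theorem sum_incrCorr_nonneg (hs : 0 < s) {j n : ℕ} (h : j < n) :
    0 ≤ ∑ l ∈ Finset.range n, incrCorr s j l := by
  have htel : ∀ l, incrCorr s j l =
      -((|(j : ℝ) + 1 - (l + 1 : ℕ)| ^ s - |(j : ℝ) - (l + 1 : ℕ)| ^ s) / 2
        - (|(j : ℝ) + 1 - l| ^ s - |(j : ℝ) - l| ^ s) / 2) := fun l => by
    rw [incrCorr]; push_cast
    rw [show (j : ℝ) + 1 - (l + 1) = j - l by ring]; ring
  rw [Finset.sum_congr rfl fun l _ => htel l, Finset.sum_neg_distrib,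
    Finset.sum_range_sub 
      (fun l : ℕ => (|(j : ℝ) + 1 - l| ^ s - |(j : ℝ) - l| ^ s) / 2)]
  have hn : (j : ℝ) + 1 ≤ n := by exact_mod_cast h
  have h1 : |(j : ℝ)| ^ s ≤ |(j : ℝ) + 1| ^ s := by
    refine Real.rpow_le_rpow (abs_nonneg _) ?_ hs.le
    rw [abs_of_nonneg (by positivity), abs_of_nonneg (by positivity)]; linarith
  have h2 : |(j : ℝ) + 1 - n| ^ s ≤ |(j : ℝ) - n| ^ s := by
    refine Real.rpow_le_rpow (abs_nonneg _) ?_ hs.le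
    rw [abs_of_nonpos (by linarith), abs_of_nonpos (by linarith)]; linarith
  simp only [Nat.cast_zero, sub_zero]
  linarith

/-- The diagonal entry is 1 and all others are nonpositive, so the absolute row sum is 2 minus the
row sum, and the latter is nonnegative. -/
theorem sum_abs_incrCorr_le (hs : 0 < s) (hs1 : s ≤ 1) {j n : ℕ} (h : j < n) :
    ∑ l ∈ Finset.range n, |incrCorr s j l| ≤ 2 := by
  have habs : ∀ l, |incrCorr s j l| = (if l = j then 2 else 0) - incrCorr s j l := fun l => by
    split_ifs with hl
    · rw [hl, incrCorr_self hs]; norm_num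
    · rw [abs_of_nonpos (incrCorr_nonpos hs hs1 hl)]; ring
  simp_rw [habs, Finset.sum_sub_distrib]
  rw [Finset.sum_ite_eq' , if_pos (Finset.mem_range.2 h)]
  linarith [sum_incrCorr_nonneg hs h]

/-- Schur's test for a symmetric matrix with absolute row sums at most 2. -/
theorem sum_incrCorr_quadratic_le (hs : 0 < s) (hs1 : s ≤ 1) (n : ℕ) (c : ℕ → ℝ) :
    ∑ j ∈ Finset.range n, ∑ l ∈ Finset.range n, c j * c l * incrCorr s j l
      ≤ 2 * ∑ j ∈ Finset.range n, c j ^ 2 := by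
  have hterm : ∀ j l, c j * c l * incrCorr s j l
      ≤ c j ^ 2 * |incrCorr s j l| / 2 + c l ^ 2 * |incrCorr s l j| / 2 := fun j l => by
    rw [incrCorr_comm s l j]
    calc c j * c l * incrCorr s j l ≤ |c j * c l * incrCorr s j l| := le_abs_self _
      _ = |c j| * |c l| * |incrCorr s j l| := by rw [abs_mul, abs_mul]
      _ ≤ ((c j ^ 2 + c l ^ 2) / 2) * |incrCorr s j l| := by
        refine mul_le_mul_of_nonneg_right ?_ (abs_nonneg _)
        nlinarith [sq_nonneg (|c j| - |c l|), sq_abs (c j), sq_abs (c l)]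
      _ = _ := by ring
  calc ∑ j ∈ Finset.range n, ∑ l ∈ Finset.range n, c j * c l * incrCorr s j l
      ≤ ∑ j ∈ Finset.range n, ∑ l ∈ Finset.range n,
          (c j ^ 2 * |incrCorr s j l| / 2 + c l ^ 2 * |incrCorr s l j| / 2) :=
        Finset.sum_le_sum fun j _ => Finset.sum_le_sum fun l _ => hterm j l
    _ = ∑ j ∈ Finset.range n, c j ^ 2 * ∑ l ∈ Finset.range n, |incrCorr s j l| := by
        simp_rw [Finset.sum_add_distrib]
        rw [Finset.sum_comm (f := fun j l => c l ^ 2 * |incrCorr s l j| / 2),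
          ← Finset.sum_add_distrib]
        refine Finset.sum_congr rfl fun j _ => ?_
        rw [← Finset.sum_add_distrib, Finset.mul_sum]
        exact Finset.sum_congr rfl fun l _ => by ring
    _ ≤ ∑ j ∈ Finset.range n, c j ^ 2 * 2 := Finset.sum_le_sum fun j hj =>
        mul_le_mul_of_nonneg_left (sum_abs_incrCorr_le hs hs1 (Finset.mem_range.1 hj))
          (sq_nonneg _)
    _ = _ := by rw [← Finset.sum_mul, mul_comm]

end Correlation

/-! ### Increments of the fractional sheet -/

theorem sheetIncrement_eq_sum {Ω : Type*} (W : ℝ → ℝ → Ω → ℝ) (s t x y : ℝ) (ω : Ω) :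
    sheetIncrement W s t x y ω = ∑ e : Fin 4, (![1, -1, -1, 1] : Fin 4 → ℝ) e
      * W ((![t, s, t, s] : Fin 4 → ℝ) e) ((![y, y, x, x] : Fin 4 → ℝ) e) ω := by
  simp [Fin.sum_univ_four, sheetIncrement]
  ring

section Sheet

variable {Ω : Type*} [MeasurableSpace Ω] {P : Measure Ω}

theorem integral_sum_mul_sum {ι κ : Type*} {X : ι → Ω → ℝ} {Y : κ → Ω → ℝ}
    (I : Finset ι) (J : Finset κ) (c : ι → ℝ) (d : κ → ℝ)
    (hX : ∀ i ∈ I, MemLp (X i) 2 P) (hY : ∀ j ∈ J, MemLp (Y j) 2 P) :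
    ∫ ω, (∑ i ∈ I, c i * X i ω) * (∑ j ∈ J, d j * Y j ω) ∂P
      = ∑ i ∈ I, ∑ j ∈ J, c i * d j * ∫ ω, X i ω * Y j ω ∂P := by
  have h : ∀ ω, (∑ i ∈ I, c i * X i ω) * (∑ j ∈ J, d j * Y j ω)
      = ∑ i ∈ I, ∑ j ∈ J, c i * d j * (X i ω * Y j ω) := fun ω => by
    rw [Finset.sum_mul_sum]
    exact Finset.sum_congr rfl fun i _ => Finset.sum_congr rfl fun j _ => by ring
  simp_rw [h]
  have hint : ∀ i ∈ I, ∀ j ∈ J, Integrable (fun ω => c i * d j * (X i ω * Y j ω)) P :=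
    fun i hi j hj => ((hX i hi).integrable_mul (hY j hj)).const_mul _
  rw [integral_finsetSum _ fun i hi => integrable_finsetSum _ (hint i hi)]
  refine Finset.sum_congr rfl fun i hi => ?_
  rw [integral_finsetSum _ (hint i hi)]
  exact Finset.sum_congr rfl fun j _ => integral_const_mul _ _

variable {T H : ℝ} {W : ℝ → ℝ → Ω → ℝ}

theorem IsFractionalSheet.memLp (hW : IsFractionalSheet P T H W) {t x : ℝ}
    (ht : t ∈ Set.Icc 0 T) (hx : x ∈ Set.Icc (0 : ℝ) 1) : MemLp (W t x) 2 P :=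
  (hW.gaussian.hasGaussianLaw_eval ⟨(t, x), ht, hx⟩).memLp_two

theorem IsFractionalSheet.memLp_increment (hW : IsFractionalSheet P T H W) {s t x y : ℝ}
    (hs : s ∈ Set.Icc 0 T) (ht : t ∈ Set.Icc 0 T) (hx : x ∈ Set.Icc (0 : ℝ) 1)
    (hy : y ∈ Set.Icc (0 : ℝ) 1) : MemLp (sheetIncrement W s t x y) 2 P :=
  (((hW.memLp ht hy).sub (hW.memLp hs hy)).sub (hW.memLp ht hx)).add (hW.memLp hs hx)

theorem IsFractionalSheet.integral_increment (hW : IsFractionalSheet P T H W) {s t x y : ℝ}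
    (hs : s ∈ Set.Icc 0 T) (ht : t ∈ Set.Icc 0 T) (hx : x ∈ Set.Icc (0 : ℝ) 1)
    (hy : y ∈ Set.Icc (0 : ℝ) 1) [IsFiniteMeasure P] :
    ∫ ω, sheetIncrement W s t x y ω ∂P = 0 := by
  have hi : ∀ {a b}, a ∈ Set.Icc 0 T → b ∈ Set.Icc (0 : ℝ) 1 → Integrable (W a b) P :=
    fun ha hb => (hW.memLp ha hb).integrable (by norm_num)
  change ∫ ω, (W t y - W s y - W t x + W s x) ω ∂P = 0
  rw [integral_add' (((hi ht hy).sub (hi hs hy)).sub (hi ht hx)) (hi hs hx),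
    integral_sub' ((hi ht hy).sub (hi hs hy)) (hi ht hx), integral_sub' (hi ht hy) (hi hs hy),
    hW.centered _ ht _ hy, hW.centered _ hs _ hy, hW.centered _ ht _ hx, hW.centered _ hs _ hx]
  simp

/-- The covariance kernel is a product of a time and a space factor, so its double rectangular
difference factorizes; the powers of a single space variable cancel. -/
theorem IsFractionalSheet.covariance_increment (hW : IsFractionalSheet P T H W)
    {s t x y s' t' x' y' : ℝ}
    (hs : s ∈ Set.Icc 0 T) (ht : t ∈ Set.Icc 0 T) (hx : x ∈ Set.Icc (0 : ℝ) 1)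
    (hy : y ∈ Set.Icc (0 : ℝ) 1) (hs' : s' ∈ Set.Icc 0 T) (ht' : t' ∈ Set.Icc 0 T)
    (hx' : x' ∈ Set.Icc (0 : ℝ) 1) (hy' : y' ∈ Set.Icc (0 : ℝ) 1) :
    ∫ ω, sheetIncrement W s t x y ω * sheetIncrement W s' t' x' y' ω ∂P
      = (min t t' - min s t' - min t s' + min s s')
        * ((|y - x'| ^ (2 * H) + |x - y'| ^ (2 * H) - |y - y'| ^ (2 * H) - |x - x'| ^ (2 * H))
          / 2) := by
  have hmem : ∀ {a b c d : ℝ}, a ∈ Set.Icc 0 T → b ∈ Set.Icc 0 T → c ∈ Set.Icc (0 : ℝ) 1 →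
      d ∈ Set.Icc (0 : ℝ) 1 → ∀ e : Fin 4, (![b, a, b, a] : Fin 4 → ℝ) e ∈ Set.Icc 0 T ∧
        (![d, d, c, c] : Fin 4 → ℝ) e ∈ Set.Icc (0 : ℝ) 1 := by
    intro a b c d ha hb hc hd e
    fin_cases e
    exacts [⟨hb, hd⟩, ⟨ha, hd⟩, ⟨hb, hc⟩, ⟨ha, hc⟩]
  simp_rw [sheetIncrement_eq_sum]
  rw [integral_sum_mul_sum _ _ _ _
    (fun e _ => hW.memLp (hmem hs ht hx hy e).1 (hmem hs ht hx hy e).2)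
    (fun e _ => hW.memLp (hmem hs' ht' hx' hy' e).1 (hmem hs' ht' hx' hy' e).2)]
  have hcov := fun e e' : Fin 4 => hW.covariance _ (hmem hs ht hx hy e).1 _ (hmem hs ht hx hy e).2
    _ (hmem hs' ht' hx' hy' e').1 _ (hmem hs' ht' hx' hy' e').2
  simp_rw [hcov]
  simp only [Fin.sum_univ_four, Matrix.cons_val]
  ring

/-- The increment of the sheet over the cell `(i k, (i+1) k] × (j h, (j+1) h]`, with `k = T / m`
and `h = 1 / n`. -/
def gridIncrement (T : ℝ) (m n : ℕ) (W : ℝ → ℝ → Ω → ℝ) (i j : ℕ) (ω : Ω) : ℝ :=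
  sheetIncrement W (i * (T / m)) ((i + 1) * (T / m)) (j * (1 / (n : ℝ))) ((j + 1) * (1 / (n : ℝ))) ω

theorem grid_mem_Icc {T : ℝ} (hT : 0 ≤ T) {m i : ℕ} (hi : i < m) :
    (i : ℝ) * (T / m) ∈ Set.Icc 0 T ∧ ((i : ℝ) + 1) * (T / m) ∈ Set.Icc 0 T := by
  have hm : (0 : ℝ) < m := by exact_mod_cast Nat.zero_lt_of_lt hi
  have h1 : (i : ℝ) + 1 ≤ m := by exact_mod_cast hi
  have h2 : (m : ℝ) * (T / m) = T := mul_div_cancel₀ T hm.ne'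
  have h3 : 0 ≤ T / m := by positivity
  refine ⟨⟨by positivity, ?_⟩, by positivity, ?_⟩ <;> nlinarith

variable {m n : ℕ}

theorem IsFractionalSheet.memLp_gridIncrement (hW : IsFractionalSheet P T H W) (hT : 0 ≤ T)
    {i j : ℕ} (hi : i < m) (hj : j < n) : MemLp (gridIncrement T m n W i j) 2 P :=
  hW.memLp_increment (grid_mem_Icc hT hi).1 (grid_mem_Icc hT hi).2
    (grid_mem_Icc zero_le_one hj).1 (grid_mem_Icc zero_le_one hj).2

theorem IsFractionalSheet.integral_gridIncrement [IsFiniteMeasure P]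
    (hW : IsFractionalSheet P T H W) (hT : 0 ≤ T)
    {i j : ℕ} (hi : i < m) (hj : j < n) : ∫ ω, gridIncrement T m n W i j ω ∂P = 0 :=
  hW.integral_increment (grid_mem_Icc hT hi).1 (grid_mem_Icc hT hi).2
    (grid_mem_Icc zero_le_one hj).1 (grid_mem_Icc zero_le_one hj).2

/-- In time the sheet is Brownian, so disjoint slabs decorrelate; in space, scaling extracts
`h^(2H)` and leaves the unit-step correlation. -/
theorem IsFractionalSheet.covariance_gridIncrement (hW : IsFractionalSheet P T H W) (hT : 0 ≤ T)
    {i j i' l : ℕ} (hi : i < m) (hj : j < n) (hi' : i' < m) (hl : l < n) :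
    ∫ ω, gridIncrement T m n W i j ω * gridIncrement T m n W i' l ω ∂P
      = if i = i' then T / m * ((1 / (n : ℝ)) ^ (2 * H) * incrCorr (2 * H) j l) else 0 := by
  simp_rw [gridIncrement]
  rw [hW.covariance_increment (grid_mem_Icc hT hi).1 (grid_mem_Icc hT hi).2
    (grid_mem_Icc zero_le_one hj).1 (grid_mem_Icc zero_le_one hj).2 (grid_mem_Icc hT hi').1
    (grid_mem_Icc hT hi').2 (grid_mem_Icc zero_le_one hl).1 (grid_mem_Icc zero_le_one hl).2]
  have hk : 0 ≤ T / m := by positivity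
  have hh : (0 : ℝ) ≤ 1 / n := by positivity
  have hspace : ∀ a b : ℝ, |a * (1 / (n : ℝ)) - b * (1 / (n : ℝ))| ^ (2 * H)
      = (1 / (n : ℝ)) ^ (2 * H) * |a - b| ^ (2 * H) := fun a b => by
    rw [← sub_mul, abs_mul, abs_of_nonneg hh, mul_comm, Real.mul_rpow hh (abs_nonneg _)]
  have hmin : ∀ a b : ℝ, min (a * (T / m)) (b * (T / m)) = min a b * (T / m) := fun a b =>
    (min_mul_of_nonneg a b hk).symm
  simp_rw [hspace, hmin]
  have htime : min ((i : ℝ) + 1) (i' + 1) - min (i : ℝ) (i' + 1) - min ((i : ℝ) + 1) i'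
      + min (i : ℝ) i' = if i = i' then 1 else 0 := by
    rcases lt_trichotomy i i' with h | h | h
    · have h1 : (i : ℝ) + 1 ≤ i' := by exact_mod_cast h
      rw [if_neg h.ne, min_eq_left (by linarith), min_eq_left (by linarith), min_eq_left h1,
        min_eq_left (by linarith)]
      ring
    · subst h
      rw [if_pos rfl, min_self, min_self, min_eq_left (by linarith), min_eq_right (by linarith)]
      ring
    · have h1 : (i' : ℝ) + 1 ≤ i := by exact_mod_cast h
      rw [if_neg h.ne', min_eq_right (by linarith), min_eq_right (by linarith),
        min_eq_right (by linarith), min_eq_right (by linarith)]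
      ring
  rw [← sub_mul, ← sub_mul, ← add_mul, htime, incrCorr, add_sub_add_right_eq_sub]
  split_ifs
  · ring
  · simp

/-- Up to the factor 2, the increments behave like uncorrelated variables of variance `k h^(2H)`.
The condition `H ≤ 1/2` is needed here for the sign of the correlations. -/
theorem IsFractionalSheet.integral_sq_sum_gridIncrement_le (hW : IsFractionalSheet P T H W)
    (hT : 0 ≤ T) (hH₀ : 0 < H) (hH : H ≤ 1 / 2) (c : ℕ → ℕ → ℝ) :
    ∫ ω, (∑ i ∈ Finset.range m, ∑ j ∈ Finset.range n, c i j * gridIncrement T m n W i j ω) ^ 2 ∂P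
      ≤ T / m * (1 / (n : ℝ)) ^ (2 * H)
        * (2 * ∑ i ∈ Finset.range m, ∑ j ∈ Finset.range n, c i j ^ 2) := by
  have hmem : ∀ q ∈ Finset.range m ×ˢ Finset.range n,
      MemLp (gridIncrement T m n W q.1 q.2) 2 P := fun q hq => by
    rw [Finset.mem_product, Finset.mem_range, Finset.mem_range] at hq
    exact hW.memLp_gridIncrement hT hq.1 hq.2
  simp_rw [sq, ← Finset.sum_product' (Finset.range m) (Finset.range n)
    (fun i j => c i j * gridIncrement T m n W i j _)]
  rw [integral_sum_mul_sum (X := fun q : ℕ × ℕ => gridIncrement T m n W q.1 q.2)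
    (Y := fun q : ℕ × ℕ => gridIncrement T m n W q.1 q.2) _ _ (fun q : ℕ × ℕ => c q.1 q.2)
    (fun q : ℕ × ℕ => c q.1 q.2) hmem hmem, Finset.sum_product]
  have hin : ∀ i ∈ Finset.range m,
      ∑ j ∈ Finset.range n, ∑ q ∈ Finset.range m ×ˢ Finset.range n, c i j * c q.1 q.2
        * ∫ ω, gridIncrement T m n W i j ω * gridIncrement T m n W q.1 q.2 ω ∂P
      = T / m * (1 / (n : ℝ)) ^ (2 * H) * ∑ j ∈ Finset.range n, ∑ l ∈ Finset.range n,
          c i j * c i l * incrCorr (2 * H) j l := by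
    intro i hi
    rw [Finset.mul_sum]
    refine Finset.sum_congr rfl fun j hj => ?_
    rw [Finset.sum_product, Finset.sum_eq_single_of_mem i hi, Finset.mul_sum]
    · refine Finset.sum_congr rfl fun l hl => ?_
      rw [hW.covariance_gridIncrement hT (Finset.mem_range.1 hi) (Finset.mem_range.1 hj)
        (Finset.mem_range.1 hi) (Finset.mem_range.1 hl), if_pos rfl]
      ring
    · intro i' hi' hne
      refine Finset.sum_eq_zero fun l hl => ?_
      rw [hW.covariance_gridIncrement hT (Finset.mem_range.1 hi) (Finset.mem_range.1 hj)
        (Finset.mem_range.1 hi') (Finset.mem_range.1 hl), if_neg hne.symm, mul_zero]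
  rw [Finset.sum_congr rfl hin, ← Finset.mul_sum, Finset.mul_sum _ _ (2 : ℝ)]
  refine mul_le_mul_of_nonneg_left (Finset.sum_le_sum fun i _ => ?_) (by positivity)
  simpa only [sq] using sum_incrCorr_quadratic_le (by linarith) (by linarith) n (c i)

theorem IsFractionalSheet.hasGaussianLaw_sum_gridIncrement (hW : IsFractionalSheet P T H W)
    (hT : 0 ≤ T) (c : ℕ → ℕ → ℝ) :
    HasGaussianLaw (fun ω => ∑ i ∈ Finset.range m, ∑ j ∈ Finset.range n,
      c i j * gridIncrement T m n W i j ω) P := by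
  classical
  have hg : IsGaussianProcess
      (fun (q : Fin m × Fin n) ω => gridIncrement T m n W q.1 q.2 ω) P := by
    refine hW.gaussian.of_isGaussianProcess fun q => ?_
    have ht := grid_mem_Icc hT q.1.2
    have hx := grid_mem_Icc zero_le_one q.2.2
    let D := (Set.Icc 0 T ×ˢ Set.Icc 0 1 : Set (ℝ × ℝ))
    let p₁ : D := ⟨(_, _), ht.2, hx.2⟩
    let p₂ : D := ⟨(_, _), ht.1, hx.2⟩
    let p₃ : D := ⟨(_, _), ht.2, hx.1⟩
    let p₄ : D := ⟨(_, _), ht.1, hx.1⟩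
    let I : Finset D := {p₁, p₂, p₃, p₄}
    exact ⟨I, ContinuousLinearMap.proj ⟨p₁, by simp [I]⟩
      - ContinuousLinearMap.proj ⟨p₂, by simp [I]⟩
      - ContinuousLinearMap.proj ⟨p₃, by simp [I]⟩
      + ContinuousLinearMap.proj ⟨p₄, by simp [I]⟩, fun ω => rfl⟩
  have h := (hg.smul fun q => c q.1 q.2).hasGaussianLaw_fun_sum (I := Finset.univ)
  simp_rw [Finset.sum_range]
  simpa only [Fintype.sum_prod_type, smul_eq_mul] using h

theorem IsFractionalSheet.integral_sum_gridIncrement [IsFiniteMeasure P]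
    (hW : IsFractionalSheet P T H W) (hT : 0 ≤ T) (c : ℕ → ℕ → ℝ) :
    ∫ ω, ∑ i ∈ Finset.range m, ∑ j ∈ Finset.range n, c i j * gridIncrement T m n W i j ω ∂P
      = 0 := by
  have hint : ∀ i ∈ Finset.range m, ∀ j ∈ Finset.range n,
      Integrable (fun ω => c i j * gridIncrement T m n W i j ω) P := fun i hi j hj =>
    ((hW.memLp_gridIncrement hT (Finset.mem_range.1 hi) (Finset.mem_range.1 hj)).integrable
      (by norm_num)).const_mul _
  rw [integral_finsetSum _ fun i hi => integrable_finsetSum _ (hint i hi)]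
  refine Finset.sum_eq_zero fun i hi => ?_
  rw [integral_finsetSum _ (hint i hi)]
  refine Finset.sum_eq_zero fun j hj => ?_
  rw [integral_const_mul, hW.integral_gridIncrement hT (Finset.mem_range.1 hi)
    (Finset.mem_range.1 hj), mul_zero]

end Sheet

/-! ### The stochastic convolution of the regularized noise -/

section Noise

variable {Ω : Type*} {T : ℝ} {m n : ℕ} {W : ℝ → ℝ → Ω → ℝ}

theorem regNoise_eq (T : ℝ) (m n : ℕ) (W : ℝ → ℝ → Ω → ℝ) (s : ℝ) (ω : Ω) :
    regNoise T m n W s ω = ∑ i ∈ Finset.range m, ∑ j ∈ Finset.range n,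
      (1 / (T / m * (1 / n)) * gridIncrement T m n W i j ω
        * (Set.Ioc (i * (T / m)) ((i + 1) * (T / m))).indicator (fun _ => (1 : ℝ)) s)
        • cellIndicator (j * (1 / n)) ((j + 1) * (1 / n)) := rfl

theorem integrableOn_regNoise (T : ℝ) (m n : ℕ) (W : ℝ → ℝ → Ω → ℝ) (ω : Ω) :
    IntegrableOn (fun s => regNoise T m n W s ω) (Set.Icc 0 T) := by
  simp_rw [regNoise_eq]
  refine integrable_finsetSum _ fun i _ => integrable_finsetSum _ fun j _ => ?_
  refine Integrable.smul_const (Integrable.const_mul ?_ _) _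
  exact (integrableOn_const measure_Icc_lt_top.ne).indicator measurableSet_Ioc

theorem continuousAt_indicator_Ioc {a b s : ℝ} (ha : s ≠ a) (hb : s ≠ b) :
    ContinuousAt ((Set.Ioc a b).indicator fun _ => (1 : ℝ)) s := by
  have key : ∀ (U : Set ℝ) (c : ℝ), IsOpen U → s ∈ U →
      (∀ x ∈ U, (Set.Ioc a b).indicator (fun _ => (1 : ℝ)) x = c) →
      ContinuousAt ((Set.Ioc a b).indicator fun _ => (1 : ℝ)) s := fun U c hU hs h =>
    continuousAt_const.congr (f := fun _ => c)
      (Filter.eventuallyEq_of_mem (hU.mem_nhds hs) fun x hx => (h x hx).symm)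
  rcases lt_or_gt_of_ne ha with h | h
  · exact key (Set.Iio a) 0 isOpen_Iio h fun x hx =>
      Set.indicator_of_notMem (fun hx' => absurd hx'.1 (not_lt.2 (le_of_lt hx))) _
  rcases lt_or_gt_of_ne hb with h' | h'
  · exact key (Set.Ioo a b) 1 isOpen_Ioo ⟨h, h'⟩ fun x hx =>
      Set.indicator_of_mem (Set.Ioo_subset_Ioc_self hx) _
  · exact key (Set.Ioi b) 0 isOpen_Ioi h' fun x hx =>
      Set.indicator_of_notMem (fun hx' => absurd hx'.2 (not_le.2 hx)) _

theorem continuousAt_regNoise (T : ℝ) (m n : ℕ) (W : ℝ → ℝ → Ω → ℝ) (ω : Ω) {s : ℝ}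
    (hs : s ∉ Set.range fun i : ℕ => (i : ℝ) * (T / m)) :
    ContinuousAt (fun s => regNoise T m n W s ω) s := by
  simp_rw [regNoise_eq]
  refine tendsto_finsetSum _ fun i _ => tendsto_finsetSum _ fun j _ => ?_
  refine ContinuousAt.smul (continuousAt_const.mul (continuousAt_indicator_Ioc ?_ ?_))
    continuousAt_const
  · rintro rfl; exact hs ⟨i, rfl⟩
  · rintro rfl; exact hs ⟨i + 1, by push_cast; rfl⟩

/-- The integral over `(i k, (i+1) k] ∩ (0, t]` of the Green's function of the mode `a`. -/
def timeCoeff (T : ℝ) (m i a : ℕ) (t : ℝ) : ℝ :=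
  ∫ s in (0 : ℝ)..t, Real.sin (Real.sqrt (eigval a) * (t - s)) / Real.sqrt (eigval a)
    * (Set.Ioc (i * (T / m)) ((i + 1) * (T / m))).indicator (fun _ => (1 : ℝ)) s

/-- The coefficient of the increment over the cell `(i, j)` in the mode `a` of the stochastic
convolution. -/
def noiseCoeff (T : ℝ) (m n a : ℕ) (t : ℝ) (i j : ℕ) : ℝ :=
  1 / (T / m * (1 / n)) * timeCoeff T m i a t
    * inner ℝ (eigvec a) (cellIndicator (j * (1 / n)) ((j + 1) * (1 / n)))

/-- The mode `a` of the stochastic convolution. -/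
def noiseMode (T : ℝ) (m n : ℕ) (W : ℝ → ℝ → Ω → ℝ) (a : ℕ) (t : ℝ) (ω : Ω) : ℝ :=
  ∑ i ∈ Finset.range m, ∑ j ∈ Finset.range n,
    noiseCoeff T m n a t i j * gridIncrement T m n W i j ω

theorem intervalIntegrable_mul_indicator {F : ℝ → ℝ} (hF : Continuous F) (a b c d : ℝ) :
    IntervalIntegrable (fun s => F s * (Set.Ioc a b).indicator (fun _ => (1 : ℝ)) s)
      volume c d := by
  have h : ∀ s, F s * (Set.Ioc a b).indicator (fun _ => (1 : ℝ)) s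
      = (Set.Ioc a b).indicator F s := fun s => by
    simp only [Set.indicator]; split_ifs <;> simp
  simp_rw [h]
  have := hF.intervalIntegrable (μ := volume) c d
  exact ⟨this.1.indicator measurableSet_Ioc, this.2.indicator measurableSet_Ioc⟩

theorem continuous_green_coeff (a : ℕ) (t : ℝ) :
    Continuous fun s => Real.sin (Real.sqrt (eigval a) * (t - s)) / Real.sqrt (eigval a) := by
  fun_prop

/-- Exhibits the mode as a finite combination of increments with deterministic coefficients, which
makes it Gaussian. -/
theorem inner_integral_greenOp_regNoise {t : ℝ} (ht : t ∈ Set.Icc 0 T) (a : ℕ) (ω : Ω) :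
    inner ℝ (eigvec a) (∫ s in (0 : ℝ)..t, greenOp (t - s) (regNoise T m n W s ω))
      = noiseMode T m n W a t ω := by
  rw [inner_integral_greenOp ht.1
    ((integrableOn_regNoise T m n W ω).mono_set (Set.Icc_subset_Icc_right ht.2))]
  set e : ℕ → ℝ := fun j => inner ℝ (eigvec a) (cellIndicator (j * (1 / n)) ((j + 1) * (1 / n)))
    with he
  have h : ∀ s, Real.sin (Real.sqrt (eigval a) * (t - s)) / Real.sqrt (eigval a)
      * inner ℝ (eigvec a) (regNoise T m n W s ω)
      = ∑ i ∈ Finset.range m, ∑ j ∈ Finset.range n,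
        (1 / (T / m * (1 / n)) * gridIncrement T m n W i j ω * e j)
        * (Real.sin (Real.sqrt (eigval a) * (t - s)) / Real.sqrt (eigval a)
        * (Set.Ioc (i * (T / m)) ((i + 1) * (T / m))).indicator (fun _ => (1 : ℝ)) s) := by
    intro s
    rw [regNoise_eq, inner_sum, Finset.mul_sum]
    refine Finset.sum_congr rfl fun i _ => ?_
    rw [inner_sum, Finset.mul_sum]
    refine Finset.sum_congr rfl fun j _ => ?_
    rw [inner_smul_right]
    ring
  simp_rw [h]
  have hint : ∀ i j : ℕ, IntervalIntegrable (fun s =>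
      (1 / (T / m * (1 / n)) * gridIncrement T m n W i j ω * e j)
        * (Real.sin (Real.sqrt (eigval a) * (t - s)) / Real.sqrt (eigval a)
        * (Set.Ioc (i * (T / m)) ((i + 1) * (T / m))).indicator (fun _ => (1 : ℝ)) s))
      volume 0 t := fun i j =>
    (intervalIntegrable_mul_indicator (continuous_green_coeff a t) _ _ _ _).const_mul _
  rw [intervalIntegral.integral_finsetSum fun i _ => by
    simpa only [Finset.sum_fn] using IntervalIntegrable.sum (Finset.range n) fun j _ => hint i j]
  refine Finset.sum_congr rfl fun i _ => ?_
  rw [intervalIntegral.integral_finsetSum fun j _ => hint i j]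
  refine Finset.sum_congr rfl fun j _ => ?_
  rw [intervalIntegral.integral_const_mul, noiseCoeff, timeCoeff]
  ring

/-- The slab length `k` appearing here cancels the `1 / k` in the regularized noise. -/
theorem abs_timeCoeff_le {t : ℝ} (hT : 0 ≤ T) (ht : 0 ≤ t) (m i a : ℕ) :
    |timeCoeff T m i a t| ≤ T / m * (Real.sqrt (eigval a))⁻¹ := by
  have hk : 0 ≤ T / m := by positivity
  have hr := sqrt_eigval_pos a
  set J := Set.Ioc ((i : ℝ) * (T / m)) ((i + 1) * (T / m)) with hJ
  have hJi : Integrable (J.indicator fun _ => (Real.sqrt (eigval a))⁻¹) :=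
    (integrable_indicator_iff measurableSet_Ioc).2 (integrableOn_const measure_Ioc_lt_top.ne)
  calc |timeCoeff T m i a t|
      ≤ ∫ s in (0 : ℝ)..t, J.indicator (fun _ => (Real.sqrt (eigval a))⁻¹) s := by
        rw [timeCoeff, ← Real.norm_eq_abs]
        refine intervalIntegral.norm_integral_le_of_norm_le ht
          (Filter.Eventually.of_forall fun s _ => ?_) hJi.intervalIntegrable
        rw [norm_mul, norm_div, Real.norm_eq_abs, Real.norm_eq_abs, abs_of_pos hr]
        simp only [Set.indicator, ← hJ]
        split_ifs
        · rw [norm_one, mul_one, div_eq_mul_inv]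
          exact mul_le_of_le_one_left (by positivity) (Real.abs_sin_le_one _)
        · simp
    _ ≤ ∫ s, J.indicator (fun _ => (Real.sqrt (eigval a))⁻¹) s := by
        rw [intervalIntegral.integral_of_le ht]
        exact setIntegral_le_integral hJi (Filter.Eventually.of_forall fun s =>
          Set.indicator_nonneg (fun _ _ => by positivity) s)
    _ = T / m * (Real.sqrt (eigval a))⁻¹ := by
        rw [integral_indicator measurableSet_Ioc, setIntegral_const, Real.volume_real_Ioc_of_le
          (by nlinarith), smul_eq_mul]
        ring

/-- The addition formula separates `t` from `s` in the kernel, leaving primitives of integrable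
functions. Continuity in `t` serves joint measurability of the noise in `(ω, t)`. -/
theorem continuous_timeCoeff (T : ℝ) (m i a : ℕ) : Continuous (timeCoeff T m i a) := by
  set r := Real.sqrt (eigval a) with hr
  set J := Set.Ioc ((i : ℝ) * (T / m)) ((i + 1) * (T / m)) with hJ
  have hc : Continuous fun s => Real.cos (r * s) := by fun_prop
  have hs : Continuous fun s => Real.sin (r * s) := by fun_prop
  have hci := fun c d => intervalIntegrable_mul_indicator hc (i * (T / m)) ((i + 1) * (T / m)) c d
  have hsi := fun c d => intervalIntegrable_mul_indicator hs (i * (T / m)) ((i + 1) * (T / m)) c d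
  have h : timeCoeff T m i a = fun t =>
      Real.sin (r * t) / r * (∫ s in (0 : ℝ)..t, Real.cos (r * s) * J.indicator (fun _ => (1 : ℝ)) s)
      - Real.cos (r * t) / r
        * ∫ s in (0 : ℝ)..t, Real.sin (r * s) * J.indicator (fun _ => (1 : ℝ)) s := by
    funext t
    rw [← intervalIntegral.integral_const_mul, ← intervalIntegral.integral_const_mul,
      ← intervalIntegral.integral_sub ((hci 0 t).const_mul _) ((hsi 0 t).const_mul _), timeCoeff]
    refine intervalIntegral.integral_congr fun s _ => ?_
    simp only [mul_sub, Real.sin_sub, ← hr, ← hJ]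
    ring
  rw [h]
  exact ((by fun_prop : Continuous fun t => Real.sin (r * t) / r).mul
    (intervalIntegral.continuous_primitive hci 0)).sub
    ((by fun_prop : Continuous fun t => Real.cos (r * t) / r).mul
    (intervalIntegral.continuous_primitive hsi 0))

theorem continuous_noiseCoeff (T : ℝ) (m n a i j : ℕ) :
    Continuous fun t => noiseCoeff T m n a t i j :=
  (continuous_const.mul (continuous_timeCoeff T m i a)).mul continuous_const

theorem norm_cellIndicator_sq_le (j n : ℕ) :
    ‖cellIndicator (j * (1 / n)) ((j + 1) * (1 / n))‖ ^ 2 ≤ 1 / n := by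
  have hn : (0 : ℝ) ≤ 1 / n := by positivity
  rw [cellIndicator, norm_indicatorConstLp (by norm_num) (by norm_num), norm_one, one_mul,
    ENNReal.toReal_ofNat, ← Real.sqrt_eq_rpow, Real.sq_sqrt measureReal_nonneg]
  calc (volume.restrict (Set.Ioo (0 : ℝ) 1)).real (Set.Ioc (j * (1 / n)) ((j + 1) * (1 / n)))
      ≤ volume.real (Set.Ioc ((j : ℝ) * (1 / n)) ((j + 1) * (1 / n))) :=
        ENNReal.toReal_mono measure_Ioc_lt_top.ne (Measure.restrict_apply_le _ _)
    _ = 1 / n := by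
        rw [Real.volume_real_Ioc_of_le (by nlinarith)]; ring

/-- The `L²` norm of the modes `a ≥ N` of the stochastic convolution. -/
def noiseTail (T : ℝ) (m n : ℕ) (W : ℝ → ℝ → Ω → ℝ) (N : ℕ) (t : ℝ) (ω : Ω) : ℝ≥0∞ :=
  (∑' a, ENNReal.ofReal ((tailCoeff N a * noiseMode T m n W a t ω) ^ 2)) ^ (1 / 2 : ℝ)

theorem enorm_tailProj_noise {t : ℝ} (ht : t ∈ Set.Icc 0 T) (N : ℕ) (ω : Ω) :
    ‖tailProj N (∫ s in (0 : ℝ)..t, greenOp (t - s) (regNoise T m n W s ω))‖ₑ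
      = noiseTail T m n W N t ω := by
  have h := enorm_diagOp orthonormal_eigvec (abs_tailCoeff_le N)
    (∫ s in (0 : ℝ)..t, greenOp (t - s) (regNoise T m n W s ω))
  simp_rw [inner_integral_greenOp_regNoise ht] at h
  exact h

theorem tailCoeff_mul_noiseMode (N a : ℕ) (t : ℝ) (ω : Ω) :
    tailCoeff N a * noiseMode T m n W a t ω = ∑ i ∈ Finset.range m, ∑ j ∈ Finset.range n,
      (tailCoeff N a * noiseCoeff T m n a t i j) * gridIncrement T m n W i j ω := by
  simp_rw [noiseMode, Finset.mul_sum, mul_assoc]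

/-- Sum over the modes `a ≥ N` of the variance bounds. -/
theorem tsum_noise_variance_le {T H t : ℝ} (hT : 0 < T) (ht : 0 ≤ t) (hm : 1 ≤ m) (hn : 1 ≤ n)
    (N : ℕ) :
    ∑' a, ENNReal.ofReal (T / m * (1 / (n : ℝ)) ^ (2 * H)
        * (2 * ∑ i ∈ Finset.range m, ∑ j ∈ Finset.range n,
          (tailCoeff N a * noiseCoeff T m n a t i j) ^ 2))
      ≤ ENNReal.ofReal (2 * T * ((1 / (n : ℝ)) ^ (H - 1)) ^ 2 * ((N : ℝ) + 1)⁻¹ ^ 2) := by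
  have hm0 : (0 : ℝ) < m := by exact_mod_cast hm
  have hn0 : (0 : ℝ) < n := by exact_mod_cast hn
  set h : ℝ := 1 / n with hh
  have hh0 : 0 < h := by positivity
  set k : ℝ := T / m with hk
  have hk0 : 0 < k := by positivity
  set χ : ℕ → L2O := fun j => cellIndicator (j * h) ((j + 1) * h) with hχ
  set B : ℝ := 2 * T * (h ^ (2 * H) * (h⁻¹) ^ 2) * ((N : ℝ) + 1)⁻¹ ^ 2 with hB
  have hB0 : 0 ≤ B := by positivity
  have hmk : (m : ℝ) * k = T := mul_div_cancel₀ T hm0.ne'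
  have hcoef : ∀ a i j, (tailCoeff N a * noiseCoeff T m n a t i j) ^ 2
      ≤ (h⁻¹) ^ 2 * ((N : ℝ) + 1)⁻¹ ^ 2 * inner ℝ (eigvec a) (χ j) ^ 2 := by
    intro a i j
    have h1 : |tailCoeff N a * (1 / (k * h) * timeCoeff T m i a t)|
        ≤ h⁻¹ * ((N : ℝ) + 1)⁻¹ := by
      by_cases ha : N ≤ a
      · rw [tailCoeff, if_pos ha, one_mul, abs_mul, abs_of_pos (by positivity)]
        calc 1 / (k * h) * |timeCoeff T m i a t|
            ≤ 1 / (k * h) * (k * ((N : ℝ) + 1)⁻¹) := by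
              refine mul_le_mul_of_nonneg_left ((abs_timeCoeff_le hT.le ht m i a).trans ?_)
                (by positivity)
              have := add_one_le_sqrt_eigval ha
              gcongr
          _ = h⁻¹ * ((N : ℝ) + 1)⁻¹ := by field_simp
      · rw [tailCoeff, if_neg ha, zero_mul, abs_zero]; positivity
    calc (tailCoeff N a * noiseCoeff T m n a t i j) ^ 2
        = |tailCoeff N a * (1 / (k * h) * timeCoeff T m i a t)| ^ 2
          * inner ℝ (eigvec a) (χ j) ^ 2 := by
          rw [sq_abs, noiseCoeff, ← mul_pow]; ring
      _ ≤ (h⁻¹ * ((N : ℝ) + 1)⁻¹) ^ 2 * inner ℝ (eigvec a) (χ j) ^ 2 := by gcongr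
      _ = _ := by rw [mul_pow]
  -- The coefficient bound does not depend on `i`, so the sum over slabs contributes a factor `m`,
  -- and `m k = T` removes the time step.
  have hterm : ∀ a, k * h ^ (2 * H) * (2 * ∑ i ∈ Finset.range m, ∑ j ∈ Finset.range n,
      (tailCoeff N a * noiseCoeff T m n a t i j) ^ 2)
      ≤ B * ∑ j ∈ Finset.range n, inner ℝ (eigvec a) (χ j) ^ 2 := by
    intro a
    calc _ ≤ k * h ^ (2 * H) * (2 * ∑ i ∈ Finset.range m, ∑ j ∈ Finset.range n,
          (h⁻¹) ^ 2 * ((N : ℝ) + 1)⁻¹ ^ 2 * inner ℝ (eigvec a) (χ j) ^ 2) := by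
          gcongr with i _ j _
          exact hcoef a i j
      _ = _ := by
          simp_rw [← Finset.mul_sum]
          rw [Finset.sum_const, Finset.card_range, nsmul_eq_mul, hB, ← hmk]
          ring
  -- Bessel's inequality: one cell costs its length `h`, and the `n` cells together cost `n h = 1`.
  have hbessel : ∀ j, ∑' a, ENNReal.ofReal (inner ℝ (eigvec a) (χ j) ^ 2) ≤ ENNReal.ofReal h := by
    intro j
    have hs := orthonormal_eigvec.inner_products_summable (x := χ j)
    simp_rw [Real.norm_eq_abs, sq_abs] at hs
    rw [← ENNReal.ofReal_tsum_of_nonneg (fun a => sq_nonneg _) hs]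
    refine ENNReal.ofReal_le_ofReal ?_
    have hb := orthonormal_eigvec.tsum_inner_products_le (χ j)
    simp_rw [Real.norm_eq_abs, sq_abs] at hb
    exact hb.trans (norm_cellIndicator_sq_le j n)
  calc _ ≤ ∑' a, ENNReal.ofReal B
        * ∑ j ∈ Finset.range n, ENNReal.ofReal (inner ℝ (eigvec a) (χ j) ^ 2) := by
        refine ENNReal.tsum_le_tsum fun a => (ENNReal.ofReal_le_ofReal (hterm a)).trans_eq ?_
        rw [ENNReal.ofReal_mul hB0, ENNReal.ofReal_sum_of_nonneg fun j _ => sq_nonneg _]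
    _ = ENNReal.ofReal B
        * ∑ j ∈ Finset.range n, ∑' a, ENNReal.ofReal (inner ℝ (eigvec a) (χ j) ^ 2) := by
        rw [ENNReal.tsum_mul_left, Summable.tsum_finsetSum fun _ _ => ENNReal.summable]
    _ ≤ ENNReal.ofReal B * ∑ j ∈ Finset.range n, ENNReal.ofReal h := by
        gcongr with j _
        exact hbessel j
    _ = ENNReal.ofReal (2 * T * (h ^ (H - 1)) ^ 2 * ((N : ℝ) + 1)⁻¹ ^ 2) := by
        rw [Finset.sum_const, Finset.card_range, nsmul_eq_mul, ← ENNReal.ofReal_natCast,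
          ← ENNReal.ofReal_mul hn0.le, ← ENNReal.ofReal_mul hB0, hB]
        congr 1
        have e1 : (n : ℝ) * h = 1 := by rw [hh]; field_simp
        have e2 : (h ^ (H - 1)) ^ 2 = h ^ (2 * H) * (h⁻¹) ^ 2 := by
          rw [Real.rpow_sub hh0, Real.rpow_one, div_pow, mul_comm 2 H, Real.rpow_mul hh0.le,
            Real.rpow_ofNat, inv_pow, div_eq_mul_inv]
        rw [e1, mul_one, e2]

variable [MeasurableSpace Ω] {P : Measure Ω} {H : ℝ}

theorem lpNorm_noiseTail_le [IsProbabilityMeasure P] (hW : IsFractionalSheet P T H W) (hT : 0 < T)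
    (hH₀ : 0 < H) (hH : H ≤ 1 / 2) (hm : 1 ≤ m) (hn : 1 ≤ n) {p : ℝ} (hp : 2 ≤ p) (N : ℕ) {t : ℝ}
    (ht : t ∈ Set.Icc 0 T) :
    lpNorm p P (noiseTail T m n W N t)
      ≤ gaussMoment p ^ (1 / p) * ENNReal.ofReal (Real.sqrt (2 * T))
        * ENNReal.ofReal ((1 / (n : ℝ)) ^ (H - 1)) * ENNReal.ofReal ((N : ℝ) + 1)⁻¹ := by
  have h := lpNorm_l2_le_of_gaussian (P := P)
    (X := fun a ω => tailCoeff N a * noiseMode T m n W a t ω)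
    (v := fun a => T / m * (1 / (n : ℝ)) ^ (2 * H)
        * (2 * ∑ i ∈ Finset.range m, ∑ j ∈ Finset.range n,
          (tailCoeff N a * noiseCoeff T m n a t i j) ^ 2))
    (fun a => by
      simp_rw [tailCoeff_mul_noiseMode]; exact hW.hasGaussianLaw_sum_gridIncrement hT.le _)
    (fun a => by simp_rw [tailCoeff_mul_noiseMode]; exact hW.integral_sum_gridIncrement hT.le _) hp
    (fun a => by
      simp_rw [tailCoeff_mul_noiseMode]
      exact hW.integral_sq_sum_gridIncrement_le hT.le hH₀ hH _)
  refine h.trans ?_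
  rw [mul_assoc, mul_assoc]
  refine mul_le_mul_right ((ENNReal.rpow_le_rpow (tsum_noise_variance_le hT ht.1 hm hn N)
    (by norm_num)).trans_eq ?_) _
  rw [ENNReal.ofReal_rpow_of_nonneg (by positivity) (by norm_num), ← Real.sqrt_eq_rpow,
    Real.sqrt_mul (by positivity), Real.sqrt_mul (by positivity), Real.sqrt_sq (by positivity),
    Real.sqrt_sq (by positivity), ENNReal.ofReal_mul (by positivity),
    ENNReal.ofReal_mul (by positivity), mul_assoc]

theorem aemeasurable_noiseTail (hW : IsFractionalSheet P T H W) (hT : 0 ≤ T) (N : ℕ) (ν : Measure ℝ)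
    [SFinite P] [SFinite ν] :
    AEMeasurable (fun q : Ω × ℝ => noiseTail T m n W N q.2 q.1) (P.prod ν) := by
  refine (AEMeasurable.tsum fun a => ?_).pow_const _
  refine ((AEMeasurable.const_mul ?_ _).pow_const 2).ennreal_ofReal
  refine Finset.aemeasurable_fun_sum _ fun i hi => Finset.aemeasurable_fun_sum _ fun j hj => ?_
  exact ((continuous_noiseCoeff T m n a i j).measurable.comp measurable_snd).aemeasurable.mul
    (hW.memLp_gridIncrement hT (Finset.mem_range.1 hi)
      (Finset.mem_range.1 hj)).aestronglyMeasurable.aemeasurable.comp_fst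

theorem aemeasurable_noiseTail_slice (hW : IsFractionalSheet P T H W) (hT : 0 ≤ T) (N : ℕ) (t : ℝ) :
    AEMeasurable (noiseTail T m n W N t) P := by
  refine (AEMeasurable.tsum fun a => ?_).pow_const _
  refine ((AEMeasurable.const_mul ?_ _).pow_const 2).ennreal_ofReal
  refine Finset.aemeasurable_fun_sum _ fun i hi => Finset.aemeasurable_fun_sum _ fun j hj => ?_
  exact (hW.memLp_gridIncrement hT (Finset.mem_range.1 hi)
      (Finset.mem_range.1 hj)).aestronglyMeasurable.aemeasurable.const_mul _

end Noise

/-! ### The pathwise error bound -/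

section PathError

variable {T : ℝ} {b : ℝ → ℝ} {K : ℝ≥0} (hb : LipschitzWith K b) {u₀ v₀ : L2O} {η u : ℝ → L2O}

/-- The data on which a path of the mild solution depends, apart from the noise. -/
def dataSize (T : ℝ) (b : ℝ → ℝ) (u₀ v₀ : L2O) : ℝ≥0∞ :=
  ‖v₀‖ₑ + hdotNorm 1 u₀ + ENNReal.ofReal T * ENNReal.ofReal |b 0|

/-- The stochastic convolution along a path. -/
def convolution (η : ℝ → L2O) (t : ℝ) : L2O := ∫ s in (0 : ℝ)..t, greenOp (t - s) (η s)

theorem enorm_tailProj_le_dataSize (N : ℕ) {t : ℝ} (ht : t ∈ Set.Icc 0 T)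
    (hu : IntegrableOn u (Set.Icc 0 T))
    (hmild : u t = greenOp t v₀ + greenDerivOp t u₀
      + (∫ s in (0 : ℝ)..t, greenOp (t - s) (drift hb (u s)))
      + ∫ s in (0 : ℝ)..t, greenOp (t - s) (η s)) :
    ‖tailProj N (u t)‖ₑ ≤ ENNReal.ofReal ((N : ℝ) + 1)⁻¹ * (dataSize T b u₀ v₀
        + K * ∫⁻ s in Set.Icc 0 t, ‖u s‖ₑ) + ‖tailProj N (convolution η t)‖ₑ := by
  refine (enorm_tailProj_le_of_mild hb N ht.1
    (hu.mono_set (Set.Icc_subset_Icc_right ht.2)) hmild).trans (add_le_add ?_ le_rfl)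
  refine mul_le_mul_right ?_ _
  rw [lintegral_add_left measurable_const, lintegral_const, lintegral_const_mul' _ _
    ENNReal.coe_ne_top, dataSize, add_assoc (‖v₀‖ₑ + hdotNorm 1 u₀), mul_comm (ENNReal.ofReal |b 0|)]
  gcongr
  rw [Measure.restrict_apply_univ, Real.volume_Icc]
  exact ENNReal.ofReal_le_ofReal (by linarith [ht.2])

/-- With `N = 0` the tail is `u` itself and the gain is 1, so the tail estimate becomes a Volterra
inequality for `‖u‖`. -/
theorem lintegral_enorm_mild_le (hη : IntegrableOn η (Set.Icc 0 T))
    (hu : IntegrableOn u (Set.Icc 0 T))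
    (hmild : ∀ t ∈ Set.Icc 0 T, u t = greenOp t v₀ + greenDerivOp t u₀
      + (∫ s in (0 : ℝ)..t, greenOp (t - s) (drift hb (u s)))
      + ∫ s in (0 : ℝ)..t, greenOp (t - s) (η s)) :
    ∫⁻ s in Set.Icc 0 T, ‖u s‖ₑ ≤ gronwallConst K T * (ENNReal.ofReal T * dataSize T b u₀ v₀
      + ∫⁻ s in Set.Icc 0 T, ‖tailProj 0 (convolution η s)‖ₑ) := by
  have h := lintegral_le_of_le_add_lintegral (T := T) (K := K) (f := fun t => ‖u t‖ₑ)
    (a := fun t => dataSize T b u₀ v₀ + ‖tailProj 0 (convolution η t)‖ₑ)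
    hu.aestronglyMeasurable.enorm hu.2.ne fun t ht => by
      have h1 := enorm_tailProj_le_dataSize hb 0 ht hu (hmild t ht)
      rw [tailProj_zero_of_mild hb ht.1 (hη.mono_set (Set.Icc_subset_Icc_right ht.2))
        (hu.mono_set (Set.Icc_subset_Icc_right ht.2)) (hmild t ht)] at h1
      refine h1.trans_eq ?_
      simp only [Nat.cast_zero, zero_add, inv_one, ENNReal.ofReal_one, one_mul]
      ring
  refine h.trans_eq ?_
  rw [lintegral_add_left measurable_const, lintegral_const, Measure.restrict_apply_univ,
    Real.volume_Icc, sub_zero, mul_comm (dataSize T b u₀ v₀)]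

variable {uN : ℝ → L2O} {N : ℕ} {S : Set ℝ}

/-- Gronwall is used twice: once to bound the drift in the tail through the integral of `‖u‖`, once
to close the inequality for the error. The full noise convolution enters only with the factor `1 /
(N + 1)`; elsewhere only its tail occurs. -/
theorem enorm_galerkin_error_le (hS : S.Countable)
    (hη : IntegrableOn η (Set.Icc 0 T)) (hηc : ∀ s ∈ Set.Ioo 0 T \ S, ContinuousAt η s)
    (hu : IntegrableOn u (Set.Icc 0 T))
    (hmild : ∀ t ∈ Set.Icc 0 T, u t = greenOp t v₀ + greenDerivOp t u₀
      + (∫ s in (0 : ℝ)..t, greenOp (t - s) (drift hb (u s)))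
      + ∫ s in (0 : ℝ)..t, greenOp (t - s) (η s))
    (hmem : ∀ t ∈ Set.Icc 0 T, uN t ∈ galerkinSpace N)
    (hc : ContinuousOn uN (Set.Icc 0 T)) (h0 : uN 0 = galerkinProj N u₀)
    (hd : ∀ t ∈ Set.Ioc 0 T, ∃ w : L2O, HasDerivWithinAt uN w (Set.Icc 0 T) t ∧
      ∀ v ∈ galerkinSpace N, inner ℝ w v = inner ℝ (galerkinProj N v₀) v
          + (∫ s in (0 : ℝ)..t, inner ℝ (uN s) (laplacian v))
          + ∫ s in (0 : ℝ)..t, inner ℝ (drift hb (uN s) + η s) v)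
    {t : ℝ} (ht : t ∈ Set.Icc 0 T) :
    ‖u t - uN t‖ₑ ≤ ENNReal.ofReal ((N : ℝ) + 1)⁻¹ * (1 + K * gronwallConst K T * ENNReal.ofReal T)
        * (dataSize T b u₀ v₀ + K * gronwallConst K T * (ENNReal.ofReal T * dataSize T b u₀ v₀
          + ∫⁻ s in Set.Icc 0 T, ‖tailProj 0 (convolution η s)‖ₑ))
      + (‖tailProj N (convolution η t)‖ₑ
        + K * gronwallConst K T * ∫⁻ s in Set.Icc 0 T, ‖tailProj N (convolution η s)‖ₑ) := by
  have hui := lintegral_enorm_mild_le hb hη hu hmild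
  set A := dataSize T b u₀ v₀ with hA
  set G := gronwallConst K T with hG
  set V := A + K * G * (ENNReal.ofReal T * A
    + ∫⁻ s in Set.Icc 0 T, ‖tailProj 0 (convolution η s)‖ₑ) with hV
  set ρ := ENNReal.ofReal ((N : ℝ) + 1)⁻¹ with hρ
  have htail : ∀ t ∈ Set.Icc 0 T, ‖tailProj N (u t)‖ₑ
      ≤ ρ * V + ‖tailProj N (convolution η t)‖ₑ := fun t ht => by
    refine (enorm_tailProj_le_dataSize hb N ht hu (hmild t ht)).trans ?_
    gcongr
    rw [hV, mul_assoc]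
    gcongr
    exact (lintegral_mono_set (Set.Icc_subset_Icc_right ht.2)).trans hui
  have hstep : ∀ t ∈ Set.Icc 0 T, ‖u t - uN t‖ₑ
      ≤ (ρ * V + ‖tailProj N (convolution η t)‖ₑ)
        + K * ∫⁻ s in Set.Icc 0 t, ‖u s - uN s‖ₑ := fun t ht =>
    (enorm_sub_galerkin_le hb hS hη hηc hu hc h0 hd ht (hmem t ht) (hmild t ht)).trans
      (add_le_add (htail t ht) le_rfl)
  have hdiff : IntegrableOn (fun s => u s - uN s) (Set.Icc 0 T) :=
    hu.sub (hc.integrableOn_compact isCompact_Icc)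
  have hgron := lintegral_le_of_le_add_lintegral hdiff.aestronglyMeasurable.enorm hdiff.2.ne hstep
  rw [lintegral_add_left measurable_const, lintegral_const, Measure.restrict_apply_univ,
    Real.volume_Icc, sub_zero] at hgron
  calc ‖u t - uN t‖ₑ ≤ (ρ * V + ‖tailProj N (convolution η t)‖ₑ)
        + K * (G * (ρ * V * ENNReal.ofReal T
          + ∫⁻ s in Set.Icc 0 T, ‖tailProj N (convolution η s)‖ₑ)) := by
        refine (hstep t ht).trans ?_
        gcongr
        exact (lintegral_mono_set (Set.Icc_subset_Icc_right ht.2)).trans hgron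
    _ = _ := by ring

end PathError

theorem aemeasurable_hdotNorm {Ω : Type*} [MeasurableSpace Ω] {P : Measure Ω} {β : ℝ}
    {f : Ω → L2O} (hf : AEStronglyMeasurable f P) : AEMeasurable (fun ω => hdotNorm β (f ω)) P := by
  refine (AEMeasurable.tsum fun a => ?_).pow_const _
  exact (((aestronglyMeasurable_const.inner hf).aemeasurable.pow_const 2).const_mul
    _).ennreal_ofReal

theorem gronwallConst_ne_top (K : ℝ≥0) (T : ℝ) : gronwallConst K T ≠ ∞ :=
  ENNReal.mul_ne_top (by simp) ENNReal.ofReal_ne_top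

end SWE

end

/-! ### Moments of the Galerkin error -/

open SWE in
theorem theorem4p3 {Ω : Type*} [MeasurableSpace Ω] (P : Measure Ω) [IsProbabilityMeasure P]
    (p T H : ℝ) (hp : 2 ≤ p) (hT : 0 < T) (hH₀ : 0 < H) (hH : H ≤ 1 / 2)
    (b : ℝ → ℝ) (K : ℝ≥0) (hb : LipschitzWith K b)
    (u₀ v₀ : Ω → SWE.L2O) (hu₀ : SWE.MemLpHdot 1 p u₀ P) (hv₀ : MemLp v₀ (ENNReal.ofReal p) P) :
    ∃ C : ℝ, ∀ W : ℝ → ℝ → Ω → ℝ, SWE.IsFractionalSheet P T H W →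
      ∀ m n N : ℕ, 1 ≤ m → 1 ≤ n → 1 ≤ N →
      ∀ u uN : ℝ → Ω → SWE.L2O,
        SWE.IsMildSolution P T hb u₀ v₀ (SWE.regNoise T m n W) u →
        SWE.IsSpectralGalerkin P T N hb u₀ v₀ (SWE.regNoise T m n W) uN →
        ∀ t ∈ Set.Icc 0 T, (∫⁻ ω, ‖u t ω - uN t ω‖ₑ ^ p ∂P) ^ (1 / p)
          ≤ ENNReal.ofReal (C * (N : ℝ)⁻¹ * (1 / (n : ℝ)) ^ (H - 1)) := by
  have hp0 : 0 < p := by linarith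
  have hp1 : 1 ≤ p := by linarith
  set G : ℝ≥0∞ := K * gronwallConst K T with hG
  have hGtop : G ≠ ∞ := ENNReal.mul_ne_top ENNReal.coe_ne_top (gronwallConst_ne_top K T)
  set τ : ℝ≥0∞ := ENNReal.ofReal T with hτ
  have hτtop : τ ≠ ∞ := ENNReal.ofReal_ne_top
  set β : ℝ≥0∞ := gaussMoment p ^ (1 / p) * ENNReal.ofReal (Real.sqrt (2 * T)) with hβ
  have hβtop : β ≠ ∞ := ENNReal.mul_ne_top
    (ENNReal.rpow_ne_top_of_nonneg (by positivity) (gaussMoment_lt_top hp0).ne)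
    ENNReal.ofReal_ne_top
  set A : Ω → ℝ≥0∞ := fun ω => dataSize T b (u₀ ω) (v₀ ω) with hA
  have hAm : AEMeasurable A P :=
    (hv₀.1.enorm.add (aemeasurable_hdotNorm hu₀.1)).add aemeasurable_const
  set α : ℝ≥0∞ := lpNorm p P A with hα
  have hαtop : α ≠ ∞ := by
    have h1 : lpNorm p P (fun ω => ‖v₀ ω‖ₑ) ≠ ∞ := by
      have h := hv₀.2
      rw [eLpNorm_lt_top_iff_lintegral_rpow_enorm_lt_top (by simpa using hp0) (by simp),
        ENNReal.toReal_ofReal hp0.le] at h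
      exact ENNReal.rpow_ne_top_of_nonneg (by positivity) h.ne
    have h2 : lpNorm p P (fun ω => hdotNorm 1 (u₀ ω)) ≠ ∞ :=
      ENNReal.rpow_ne_top_of_nonneg (by positivity) hu₀.2.ne
    refine ne_top_of_le_ne_top (ENNReal.add_ne_top.2 ⟨ENNReal.add_ne_top.2 ⟨h1, h2⟩,
      ENNReal.mul_ne_top hτtop (ENNReal.ofReal_ne_top (r := |b 0|))⟩) ?_
    refine (lpNorm_add_le hp1 (hv₀.1.enorm.add (aemeasurable_hdotNorm hu₀.1))
      aemeasurable_const).trans (add_le_add (lpNorm_add_le hp1 hv₀.1.enorm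
        (aemeasurable_hdotNorm hu₀.1)) (lpNorm_const hp0 _).le)
  -- The pathwise bound with the data replaced by its moment `α` and the noise by its moment
  -- constant `β`, the common factors in `h` and `N` being taken out.
  set C : ℝ≥0∞ := (1 + G * τ) * (α + G * (τ * α + τ * β)) + (β + G * (τ * β)) with hC
  have hCtop : C ≠ ∞ := by finiteness
  refine ⟨C.toReal, fun W hW m n N hm hn hN u uN hu huN t ht => ?_⟩
  set x : ℝ≥0∞ := ENNReal.ofReal ((1 / (n : ℝ)) ^ (H - 1)) with hx
  have hn0 : (0 : ℝ) < n := by exact_mod_cast hn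
  -- As `h ≤ 1` and `H < 1`, the factor `h^(H-1)` is at least 1, so the noise-free terms can be
  -- multiplied by it as well.
  have hx1 : 1 ≤ x := by
    rw [hx, ENNReal.one_le_ofReal]
    refine Real.one_le_rpow_of_pos_of_le_one_of_nonpos (by positivity) ?_ (by linarith)
    rw [div_le_one hn0]
    exact_mod_cast hn
  set ρ : ℝ≥0∞ := ENNReal.ofReal ((N : ℝ) + 1)⁻¹ with hρ
  have hρtop : ρ ≠ ∞ := ENNReal.ofReal_ne_top
  set Z : ℕ → Ω → ℝ≥0∞ := fun M ω => ∫⁻ s in Set.Icc 0 T, noiseTail T m n W M s ω with hZ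
  have hZm : ∀ M, AEMeasurable (Z M) P := fun M =>
    (aemeasurable_noiseTail hW hT.le M _).lintegral_prod_right'
  have hZn : ∀ M : ℕ, lpNorm p P (Z M) ≤ τ * (β * x * ENNReal.ofReal ((M : ℝ) + 1)⁻¹) := fun M =>
    lpNorm_lintegral_Icc_le (by linarith) (aemeasurable_noiseTail hW hT.le M _) fun s hs =>
      lpNorm_noiseTail_le hW hT hH₀ hH hm hn hp M hs
  -- Minkowski's inequality is applied only to this right-hand side, whose terms are measurable; for
  -- the left-hand side monotonicity suffices.
  have hpath : ∀ᵐ ω ∂P, ‖u t ω - uN t ω‖ₑ ≤ ρ * (1 + G * τ) * (A ω + G * (τ * A ω + Z 0 ω))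
      + (noiseTail T m n W N t ω + G * Z N ω) := by
    filter_upwards [hu, huN] with ω h1 h2
    have h := enorm_galerkin_error_le hb
      (Set.countable_range fun i : ℕ => (i : ℝ) * (T / m)) (integrableOn_regNoise T m n W ω)
      (fun s hs => continuousAt_regNoise T m n W ω hs.2) h1.1 h1.2 h2.1 h2.2.1 h2.2.2.1 h2.2.2.2 ht
    have hconv : ∀ M : ℕ, ∀ s ∈ Set.Icc 0 T,
        ‖tailProj M (convolution (fun s => regNoise T m n W s ω) s)‖ₑ = noiseTail T m n W M s ω :=
      fun M s hs => enorm_tailProj_noise hs M ω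
    rwa [setLIntegral_congr_fun measurableSet_Icc (hconv 0),
      setLIntegral_congr_fun measurableSet_Icc (hconv N), hconv N t ht] at h
  have hζm := aemeasurable_noiseTail_slice (m := m) (n := n) hW hT.le N t
  have hinner : AEMeasurable (fun ω => τ * A ω + Z 0 ω) P := (hAm.const_mul _).add (hZm 0)
  have hmid : AEMeasurable (fun ω => A ω + G * (τ * A ω + Z 0 ω)) P :=
    hAm.add (hinner.const_mul _)
  have hbound : lpNorm p P (fun ω => ‖u t ω - uN t ω‖ₑ)
      ≤ ρ * (1 + G * τ) * (α + G * (τ * α + τ * (β * x)))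
        + (β * x * ρ + G * (τ * (β * x * ρ))) := by
    refine (lpNorm_mono_ae hp0 hpath).trans ?_
    refine (lpNorm_add_le hp1 (hmid.const_mul _) (hζm.add ((hZm N).const_mul _))).trans
      (add_le_add ?_ ?_)
    · rw [lpNorm_const_mul hp0 (by finiteness)]
      gcongr
      refine (lpNorm_add_le hp1 hAm (hinner.const_mul _)).trans (add_le_add le_rfl ?_)
      rw [lpNorm_const_mul hp0 hGtop]
      gcongr
      refine (lpNorm_add_le hp1 (hAm.const_mul _) (hZm 0)).trans (add_le_add ?_ ?_)
      · rw [lpNorm_const_mul hp0 hτtop]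
      · simpa using hZn 0
    · refine (lpNorm_add_le hp1 hζm ((hZm N).const_mul _)).trans (add_le_add ?_ ?_)
      · exact lpNorm_noiseTail_le hW hT hH₀ hH hm hn hp N ht
      · rw [lpNorm_const_mul hp0 hGtop]
        gcongr
        exact hZn N
  have hN0 : (0 : ℝ) < N := by exact_mod_cast hN
  calc (∫⁻ ω, ‖u t ω - uN t ω‖ₑ ^ p ∂P) ^ (1 / p)
      ≤ ρ * (1 + G * τ) * (α + G * (τ * α + τ * (β * x)))
        + (β * x * ρ + G * (τ * (β * x * ρ))) := hbound
    _ ≤ ρ * (1 + G * τ) * (α * x + G * (τ * (α * x) + τ * (β * x)))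
        + (β * x * ρ + G * (τ * (β * x * ρ))) := by
        have : α ≤ α * x := le_mul_of_one_le_right' hx1
        gcongr
    _ = C * ρ * x := by rw [hC]; ring
    _ ≤ C * ENNReal.ofReal (N : ℝ)⁻¹ * x := by
        gcongr
        exact ENNReal.ofReal_le_ofReal (inv_anti₀ hN0 (by linarith))
    _ = ENNReal.ofReal (C.toReal * (N : ℝ)⁻¹ * (1 / (n : ℝ)) ^ (H - 1)) := by
        rw [ENNReal.ofReal_mul (by positivity), ENNReal.ofReal_mul (by positivity),
          ENNReal.ofReal_toReal hCtop]
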